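/- **Setting.** Fix $N\ge 1$ clients and integers $L,M\ge 0$. The state of a client is $s=(x,y)\in\mathcal S=\{0,\dots,L\}\times\{0,\dots,M\}$ and its action is $a\in\mathcal A=\{1,2\}$. Given parameters $\alpha,\beta_n,\mu_n(a)\in[0,1]$, put $P_{n,2}(a)=\mu_n(a)(1-\beta_n)$, $P_{n,3}(a)=(1-\mu_n(a))\beta_n$, $P_{n,1}=1-P_{n,2}-P_{n,3}$. From $(x,y)$ under action $a$, client $n$ moves to $(x,y)$ with probability $(1-\alpha)P_{n,1}(a)$, to $(\min\{x+1,L\},y)$ with probability $(1-\alpha)P_{n,2}(a)$, to $((x-1)^+,\min\{y+\mathbb 1\{x=1\},M\})$ with probability $(1-\alpha)P_{n,3}(a)$, and to $(0,0)$ with probability $\alpha$ (probabilities of coinciding targets are added). Given the joint state and action, the clients move independently; client $n$ starts from a law $\rho_n$ on $\mathcal S$, independently of the others. Let $c:\mathcal S\times\mathcal S\to[0,1]$ be a cost, $g(a)=\mathbb 1\{a=1\}$, $\gamma\in[0,1)$, $K\in\mathbb N$ and $\bar K=K/(1-\gamma)$. For a stationary randomized policy $\pi$ of client $n$ let $J_c^{\pi}(\rho_n)=\mathbb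 E^\pi\big[\sum_{t\ge0}\gamma^t c(s_n(t),s_n(t+1))\big]$, $J_g^{\pi}(\rho_n)=\mathbb E^\pi\big[\sum_{t\ge0}\gamma^t g(a_n(t))\big]$ and $J^\pi(\rho_n;\lambda)=J_c^\pi(\rho_n)+\lambda\big(J_g^\pi(\rho_n)-\bar K/N\big)$. The constrained problem is to minimize $\mathbb E^\pi\big[\sum_n\sum_t\gamma^t c(s_n(t),s_n(t+1))\big]$ over all stationary randomized policies $\pi$ from the joint state space $\mathcal S^N$ to the joint action space $\mathcal A^N$, subject to $\mathbb E^\pi\big[\sum_n\sum_t\gamma^t g(a_n(t))\big]\le\bar K$. Assume Slater's condition: for some joint policy $\bar\pi$, $0<\xi\le\bar K-\mathbb E^{\bar\pi}\big[\sum_n\sum_t\gamma^t g(a_n(t))\big]$. The soft-threshold policy with parameter $\theta\in\mathbb R^{\mathcal S}$ is $\pi_\theta(s,1)=1-\frac1{1+e^{\theta(s)}}$, $\pi_\theta(s,2)=\frac1{1+e^{\theta(s)}}$. Let $F_n(\theta)=\mathbb E\big[\nabla_\theta\log\pi_\theta(s,a)\,\nabla_\theta\log\pi_\theta(s,a)^\top\big]$,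 where $s$ follows the discounted visitation distribution $(1-\gamma)\sum_{t\ge0}\gamma^t\Pr(s_n(t)=\cdot)$ of client $n$ under $\pi_\theta$ started from $\rho_n$, and $a\sim\pi_\theta(s,\cdot)$; let $F^\dagger$ denote the Moore–Penrose inverse and $\mathcal P_\Lambda$ the projection onto the interval $\Lambda$. The primal-dual natural policy gradient method is $$\theta_{n,t+1}=\theta_{n,t}-\eta_1F_n(\theta_{n,t})^\dagger\,\nabla_\theta J^{\pi_{\theta_{n,t}}}(\rho_n;\lambda_t),\qquad \lambda_{t+1}=\mathcal P_\Lambda\Big(\lambda_t+\eta_2\sum_{n=1}^N\nabla_\lambda J^{\pi_{\theta_{n,t}}}(\rho_n;\lambda_t)\Big).$$ **Theorem.** Let $T\ge1$, $\theta_{n,0}=\mathbf 0$ for all $n$, $\lambda_0=0$, $\Lambda=\big[0,\frac{2N}{(1-\gamma)\xi}\big]$, $\eta_1=\log|\mathcal A|$ and $\eta_2=\frac{1-\gamma}{N\sqrt T}$. Then, for every decentralized policy $\pi^*=\bigotimes_n\pi_n^*$ (client $n$ acts by $\pi_n^*$ on its own state only) that is an optimal solution of the constrained problem, $$\frac1T\sum_{t=0}^{T-1}\sum_{n=1}^N\big(J_c^{\pi_{\theta_{n,t}}}(\rho_n)-J_c^{\pi_n^*}(\rho_n)\big)\le\frac{4N}{(1-\gamma)^2\sqrt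 T},$$ and $$\Big(\frac1T\sum_{t=0}^{T-1}\sum_{n=1}^NJ_g^{\pi_{\theta_{n,t}}}(\rho_n)-\bar K\Big)^+\le\frac{(2/\xi+4\xi)N^2}{(1-\gamma)^2\sqrt T}.$$ -/

import Mathlib

/-! ### Moore-Penrose inverse of a real matrix -/

/-- The four Penrose conditions: `B` is the Moore-Penrose inverse of the real matrix `A`. -/
structure IsMoorePenrose {m n : Type*} [Fintype m] [Fintype n]
    (A : Matrix m n ℝ) (B : Matrix n m ℝ) : Prop where
  mul_mul_self : A * B * A = A
  self_mul_mul : B * A * B = B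
  left_symm : (A * B).transpose = A * B
  right_symm : (B * A).transpose = B * A

theorem IsMoorePenrose.unique {m n : Type*} [Fintype m] [Fintype n]
    {A : Matrix m n ℝ} {B C : Matrix n m ℝ}
    (hB : IsMoorePenrose A B) (hC : IsMoorePenrose A C) : B = C := by
  have h1 : A * B = A * C := by
    calc A * B = (A * B).transpose := hB.left_symm.symm
      _ = ((A * C) * (A * B)).transpose := by
          rw [← Matrix.mul_assoc (A * C) A B, hC.mul_mul_self]
      _ = (A * B).transpose * (A * C).transpose := Matrix.transpose_mul _ _
      _ = (A * B) * (A * C) := by rw [hB.left_symm, hC.left_symm]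
      _ = A * C := by rw [← Matrix.mul_assoc (A * B) A C, hB.mul_mul_self]
  have h2 : B * A = C * A := by
    calc B * A = (B * A).transpose := hB.right_symm.symm
      _ = ((B * A) * (C * A)).transpose := by
          rw [Matrix.mul_assoc B A (C * A), ← Matrix.mul_assoc A C A, hC.mul_mul_self]
      _ = (C * A).transpose * (B * A).transpose := Matrix.transpose_mul _ _
      _ = (C * A) * (B * A) := by rw [hB.right_symm, hC.right_symm]
      _ = C * A := by rw [Matrix.mul_assoc C A (B * A), ← Matrix.mul_assoc A B A, hB.mul_mul_self]
  calc B = B * A * B := hB.self_mul_mul.symm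
    _ = C * (A * B) := by rw [h2, Matrix.mul_assoc]
    _ = C := by rw [h1, ← Matrix.mul_assoc, hC.self_mul_mul]

theorem exists_isMoorePenrose_of_isHermitian {n : Type*} [Fintype n] [DecidableEq n]
    {H : Matrix n n ℝ} (hH : H.IsHermitian) : ∃ B : Matrix n n ℝ, IsMoorePenrose H B := by
  set U : Matrix n n ℝ := (hH.eigenvectorUnitary : Matrix n n ℝ) with hU
  set d : n → ℝ := hH.eigenvalues with hd
  have hUU : star U * U = 1 := Unitary.coe_star_mul_self hH.eigenvectorUnitary
  have hHs : H = U * Matrix.diagonal d * star U := by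
    have := hH.spectral_theorem
    simpa [Unitary.conjStarAlgAut_apply, Function.comp_def] using this
  have hmul : ∀ a b : n → ℝ, (U * Matrix.diagonal a * star U) * (U * Matrix.diagonal b * star U)
      = U * Matrix.diagonal (fun i => a i * b i) * star U := by
    intro a b
    calc _ = U * Matrix.diagonal a * (star U * U) * Matrix.diagonal b * star U := by
            simp only [Matrix.mul_assoc]
      _ = _ := by rw [hUU, Matrix.mul_one, Matrix.mul_assoc U, Matrix.diagonal_mul_diagonal]
  have hsymm : ∀ a : n → ℝ, (U * Matrix.diagonal a * star U).transpose
      = U * Matrix.diagonal a * star U := by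
    intro a
    have hs : star U = U.transpose := by
      ext i j; simp [Matrix.star_apply]
    simp [hs, Matrix.transpose_mul, Matrix.mul_assoc]
  refine ⟨U * Matrix.diagonal (fun i => (d i)⁻¹) * star U, ?_, ?_, ?_, ?_⟩
  · conv_lhs => rw [hHs]
    rw [hmul, hmul, hHs]
    congr 3; funext i
    by_cases h : d i = 0 <;> simp [h]
  · conv_lhs => rw [hHs]
    rw [hmul, hmul]
    congr 3; funext i
    by_cases h : d i = 0 <;> simp [h]
  · rw [hHs, hmul, hsymm]
  · rw [hHs, hmul, hsymm]

theorem exists_isMoorePenrose {m n : Type*} [Fintype m] [Fintype n]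
    (A : Matrix m n ℝ) : ∃ B : Matrix n m ℝ, IsMoorePenrose A B := by
  classical
  have hHt : (A.transpose * A).transpose = A.transpose * A := by
    rw [Matrix.transpose_mul, Matrix.transpose_transpose]
  have hH : (A.transpose * A).IsHermitian := by
    rw [Matrix.IsHermitian, Matrix.conjTranspose_eq_transpose_of_trivial, hHt]
  obtain ⟨G, hG⟩ := exists_isMoorePenrose_of_isHermitian hH
  set H := A.transpose * A with hHdef
  have hGt : G.transpose = G := by
    have h : IsMoorePenrose H G.transpose := by
      refine ⟨?_, ?_, ?_, ?_⟩
      · have := congrArg Matrix.transpose hG.mul_mul_self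
        simpa [Matrix.transpose_mul, hHt, Matrix.mul_assoc] using this
      · have := congrArg Matrix.transpose hG.self_mul_mul
        simpa [Matrix.transpose_mul, hHt, Matrix.mul_assoc] using this
      · have := hG.right_symm
        rw [Matrix.transpose_mul, hHt] at this
        rw [Matrix.transpose_mul, Matrix.transpose_transpose, hHt, this]
      · have := hG.left_symm
        rw [Matrix.transpose_mul, hHt] at this
        rw [Matrix.transpose_mul, Matrix.transpose_transpose, hHt, this]
    exact h.unique hG
  have hGH : A * (G * H) = A := by
    rw [← sub_eq_zero, ← Matrix.conjTranspose_mul_self_eq_zero,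
      Matrix.conjTranspose_eq_transpose_of_trivial]
    have h1 : A.transpose * (A * (G * H) - A) = 0 := by
      rw [Matrix.mul_sub, ← Matrix.mul_assoc, ← hHdef, ← Matrix.mul_assoc, hG.mul_mul_self,
        sub_self]
    have h2 : (A * (G * H) - A).transpose = ((G * H).transpose - 1) * A.transpose := by
      rw [Matrix.transpose_sub, Matrix.transpose_mul, Matrix.sub_mul, Matrix.one_mul]
    rw [h2, Matrix.mul_assoc, h1, Matrix.mul_zero]
  refine ⟨G * A.transpose, ?_, ?_, ?_, ?_⟩
  · rw [Matrix.mul_assoc, Matrix.mul_assoc, ← hHdef, hGH]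
  · rw [Matrix.mul_assoc G A.transpose A, ← hHdef, ← Matrix.mul_assoc, hG.self_mul_mul]
  · rw [Matrix.transpose_mul, Matrix.transpose_mul, Matrix.transpose_transpose, hGt,
      Matrix.mul_assoc]
  · rw [Matrix.mul_assoc, ← hHdef, hG.right_symm]

/-- The Moore-Penrose inverse of a real matrix. -/
noncomputable def moorePenroseInv {m n : Type*} [Fintype m] [Fintype n]
    (A : Matrix m n ℝ) : Matrix n m ℝ :=
  (exists_isMoorePenrose A).choose

/-! ### Finite discounted Markov decision processes -/

/-- A stationary randomized policy: `π s a` is the probability of action `a` in state `s`. -/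
def IsPolicy {S A : Type*} [Fintype A] (π : S → A → ℝ) : Prop :=
  ∀ s, π s ∈ stdSimplex ℝ A

/-- The law of the state at time `t`, for the transition probabilities `p s a s'`, the policy `π`
and the initial law `ρ`. -/
noncomputable def stateLaw {S A : Type*} [Fintype S] [Fintype A]
    (p : S → A → S → ℝ) (π : S → A → ℝ) (ρ : S → ℝ) : ℕ → S → ℝ
  | 0 => ρ
  | t + 1 => fun s' => ∑ s, ∑ a, stateLaw p π ρ t s * π s a * p s a s'

/-- The expected stage cost at time `t`, i.e. the expectation of `k (s(t)) (a(t)) (s(t+1))`. -/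
noncomputable def expectedStageCost {S A : Type*} [Fintype S] [Fintype A]
    (p : S → A → S → ℝ) (π : S → A → ℝ) (ρ : S → ℝ) (k : S → A → S → ℝ) (t : ℕ) : ℝ :=
  ∑ s, ∑ a, ∑ s', stateLaw p π ρ t s * π s a * p s a s' * k s a s'

/-- The expected infinite-horizon discounted cost. The stage cost is bounded (the spaces are
finite), so for `0 ≤ γ < 1` the series converges absolutely and it may be summed termwise. -/
noncomputable def discountedCost {S A : Type*} [Fintype S] [Fintype A] (γ : ℝ)
    (p : S → A → S → ℝ) (π : S → A → ℝ) (ρ : S → ℝ) (k : S → A → S → ℝ) : ℝ :=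
  ∑' t : ℕ, γ ^ t * expectedStageCost p π ρ k t

/-- The (normalized) discounted state visitation distribution. -/
noncomputable def visitation {S A : Type*} [Fintype S] [Fintype A] (γ : ℝ)
    (p : S → A → S → ℝ) (π : S → A → ℝ) (ρ : S → ℝ) (s : S) : ℝ :=
  (1 - γ) * ∑' t : ℕ, γ ^ t * stateLaw p π ρ t s

/-! ### The streaming model -/

/-- The two service classes: `a₁` is high priority, `a₂` is low priority. -/
inductive ServiceClass where
  | a₁
  | a₂
  deriving DecidableEq

instance : Fintype ServiceClass :=
  ⟨{ServiceClass.a₁, ServiceClass.a₂}, fun a => by cases a <;> simp⟩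

/-- Client state `(x, y)`: buffer length `x ∈ {0, …, L}` and stall count `y ∈ {0, …, M}`. -/
abbrev ClientState (L M : ℕ) : Type := Fin (L + 1) × Fin (M + 1)

/-- `s + e_x = (min (x + 1) L, y)`. -/
def ClientState.up {L M : ℕ} (s : ClientState L M) : ClientState L M :=
  (⟨min (s.1.val + 1) L, by omega⟩, s.2)

/-- `s - e_x = ((x - 1)⁺, min (y + 1_{x = 1}) M)` (natural number subtraction is truncated). -/
def ClientState.down {L M : ℕ} (s : ClientState L M) : ClientState L M :=
  (⟨s.1.val - 1, by omega⟩, ⟨min (s.2.val + if s.1.val = 1 then 1 else 0) M, by omega⟩)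

/-- The data of the system with `N` clients: the termination probability `α`, the playback rates
`β n`, the service rates `μ n a`, the initial state laws `ρ n`, and the instantaneous cost
`c (s(t)) (s(t+1))`. -/
structure StreamingModel (N L M : ℕ) where
  α : ℝ
  β : Fin N → ℝ
  μ : Fin N → ServiceClass → ℝ
  ρ : Fin N → ClientState L M → ℝ
  c : ClientState L M → ClientState L M → ℝ
  α_mem : α ∈ Set.Icc (0 : ℝ) 1
  β_mem : ∀ n, β n ∈ Set.Icc (0 : ℝ) 1
  μ_mem : ∀ n a, μ n a ∈ Set.Icc (0 : ℝ) 1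
  ρ_mem : ∀ n, ρ n ∈ stdSimplex ℝ (ClientState L M)

namespace StreamingModel

variable {N L M : ℕ} (m : StreamingModel N L M)

/-- Probability that the buffer of client `n` grows, given no termination. -/
noncomputable def probUp (n : Fin N) (a : ServiceClass) : ℝ := m.μ n a * (1 - m.β n)

/-- Probability that the buffer of client `n` shrinks, given no termination. -/
noncomputable def probDown (n : Fin N) (a : ServiceClass) : ℝ := (1 - m.μ n a) * m.β n

/-- Probability that the state of client `n` is unchanged, given no termination. -/
noncomputable def probStay (n : Fin N) (a : ServiceClass) : ℝ :=
  1 - m.probUp n a - m.probDown n a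

/-- The transition probabilities `p_n(s' | s, a)` of client `n`. -/
noncomputable def trans (n : Fin N) (s : ClientState L M) (a : ServiceClass)
    (s' : ClientState L M) : ℝ :=
  (1 - m.α) * m.probStay n a * (if s' = s then 1 else 0)
    + (1 - m.α) * m.probUp n a * (if s' = s.up then 1 else 0)
    + (1 - m.α) * m.probDown n a * (if s' = s.down then 1 else 0)
    + m.α * (if s' = (0, 0) then 1 else 0)

/-- The constraint cost `g(a) = 1_{a = 1}`. -/
noncomputable def _root_.serviceCost (a : ServiceClass) : ℝ :=
  if a = ServiceClass.a₁ then 1 else 0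

/-! Single-client quantities -/

/-- `J_c^π(ρ_n)`. -/
noncomputable def Jc (γ : ℝ) (n : Fin N) (π : ClientState L M → ServiceClass → ℝ) : ℝ :=
  discountedCost γ (m.trans n) π (m.ρ n) (fun s _ s' => m.c s s')

/-- `J_g^π(ρ_n)`. -/
noncomputable def Jg (γ : ℝ) (n : Fin N) (π : ClientState L M → ServiceClass → ℝ) : ℝ :=
  discountedCost γ (m.trans n) π (m.ρ n) (fun _ a _ => serviceCost a)

/-- The Lagrangian value function `J^π(ρ_n; λ) = J_c^π(ρ_n) + λ (J_g^π(ρ_n) - K̄ / N)`. -/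
noncomputable def lagrangian (γ Kbar : ℝ) (n : Fin N) (π : ClientState L M → ServiceClass → ℝ)
    (lam : ℝ) : ℝ :=
  m.Jc γ n π + lam * (m.Jg γ n π - Kbar / N)

/-! The joint constrained MDP over centralized policies -/

/-- Joint transition probabilities: given the joint action, the clients move independently. -/
noncomputable def jointTrans (s : Fin N → ClientState L M) (a : Fin N → ServiceClass)
    (s' : Fin N → ClientState L M) : ℝ :=
  ∏ n, m.trans n (s n) (a n) (s' n)

/-- The joint initial law. -/
noncomputable def jointInit (s : Fin N → ClientState L M) : ℝ := ∏ n, m.ρ n (s n)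

/-- The objective of the constrained MDP, for a policy on the joint state and action spaces. -/
noncomputable def jointJc (γ : ℝ)
    (π : (Fin N → ClientState L M) → (Fin N → ServiceClass) → ℝ) : ℝ :=
  discountedCost γ m.jointTrans π m.jointInit (fun s _ s' => ∑ n, m.c (s n) (s' n))

/-- The constraint functional of the constrained MDP. -/
noncomputable def jointJg (γ : ℝ)
    (π : (Fin N → ClientState L M) → (Fin N → ServiceClass) → ℝ) : ℝ :=
  discountedCost γ m.jointTrans π m.jointInit (fun _ a _ => ∑ n, serviceCost (a n))

/-- `π` is an optimal solution of: minimize `jointJc` over all joint policies subject to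
`jointJg ≤ Kbar`. -/
def IsOptimal (γ Kbar : ℝ)
    (π : (Fin N → ClientState L M) → (Fin N → ServiceClass) → ℝ) : Prop :=
  IsPolicy π ∧ m.jointJg γ π ≤ Kbar ∧
    ∀ π' : (Fin N → ClientState L M) → (Fin N → ServiceClass) → ℝ,
      IsPolicy π' → m.jointJg γ π' ≤ Kbar → m.jointJc γ π ≤ m.jointJc γ π'

/-- Slater's condition with margin `ξ`. -/
def Slater (γ Kbar ξ : ℝ) : Prop :=
  ∃ π : (Fin N → ClientState L M) → (Fin N → ServiceClass) → ℝ,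
    IsPolicy π ∧ 0 < ξ ∧ ξ ≤ Kbar - m.jointJg γ π

end StreamingModel

/-- The decentralized joint policy `⊗ π_n`: every client acts independently on its own state. -/
noncomputable def productPolicy {N L M : ℕ}
    (π : Fin N → ClientState L M → ServiceClass → ℝ) :
    (Fin N → ClientState L M) → (Fin N → ServiceClass) → ℝ :=
  fun s a => ∏ n, π n (s n) (a n)

/-! ### The primal-dual natural policy gradient method -/

/-- The soft-threshold policy with parameter `θ`. -/
noncomputable def softPolicy {L M : ℕ} (θ : EuclideanSpace ℝ (ClientState L M))
    (s : ClientState L M) : ServiceClass → ℝ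
  | ServiceClass.a₁ => 1 - 1 / (1 + Real.exp (θ s))
  | ServiceClass.a₂ => 1 / (1 + Real.exp (θ s))

namespace StreamingModel

variable {N L M : ℕ} (m : StreamingModel N L M)

/-- The score vector `∇_θ log π_θ(s, a)`. -/
noncomputable def _root_.score {L M : ℕ} (θ : EuclideanSpace ℝ (ClientState L M))
    (s : ClientState L M) (a : ServiceClass) : EuclideanSpace ℝ (ClientState L M) :=
  gradient (fun θ' => Real.log (softPolicy θ' s a)) θ

/-- The Fisher information matrix of client `n`: the expectation of
`∇_θ log π_θ(s, a) (∇_θ log π_θ(s, a))ᵀ`, where `s` follows the discounted state visitation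
distribution of `π_θ` from `ρ_n`, and `a` follows `π_θ(s, ·)`. -/
noncomputable def fisher (γ : ℝ) (n : Fin N) (θ : EuclideanSpace ℝ (ClientState L M)) :
    Matrix (ClientState L M) (ClientState L M) ℝ :=
  ∑ s, ∑ a, (visitation γ (m.trans n) (softPolicy θ) (m.ρ n) s * softPolicy θ s a) •
    Matrix.vecMulVec (score θ s a).ofLp (score θ s a).ofLp

/-- The natural gradient direction `F(θ)† ∇_θ J^{π_θ}(ρ_n; λ)`. -/
noncomputable def naturalGradient (γ Kbar : ℝ) (n : Fin N)
    (θ : EuclideanSpace ℝ (ClientState L M)) (lam : ℝ) : EuclideanSpace ℝ (ClientState L M) :=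
  WithLp.toLp 2 (Matrix.mulVec (moorePenroseInv (m.fisher γ n θ))
    (gradient (fun θ' => m.lagrangian γ Kbar n (softPolicy θ') lam) θ).ofLp)

/-- The iterates `((θ_{n,t})_n, λ_t)` from `θ_{n,0} = 0`, `λ_0 = 0`, with constant step sizes
`η₁`, `η₂`; the dual variable is projected onto the interval `[0, b]`. -/
noncomputable def iterates (γ Kbar η₁ η₂ b : ℝ) :
    ℕ → (Fin N → EuclideanSpace ℝ (ClientState L M)) × ℝ
  | 0 => (0, 0)
  | t + 1 =>
    (fun n => (iterates γ Kbar η₁ η₂ b t).1 n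
        - η₁ • m.naturalGradient γ Kbar n ((iterates γ Kbar η₁ η₂ b t).1 n)
            (iterates γ Kbar η₁ η₂ b t).2,
      max 0 (min b ((iterates γ Kbar η₁ η₂ b t).2 + η₂ * ∑ n,
        deriv (fun l => m.lagrangian γ Kbar n (softPolicy ((iterates γ Kbar η₁ η₂ b t).1 n)) l)
          (iterates γ Kbar η₁ η₂ b t).2)))

/-- The policy `π_{θ_{n,t}}` of client `n` at iteration `t` of a run of length `T`, for
`Λ = [0, 2N / ((1-γ) ξ)]`, `η₁ = log |A|` and `η₂ = (1-γ) / (N √T)`. -/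
noncomputable def iteratePolicy (γ Kbar ξ : ℝ) (T t : ℕ) (n : Fin N) :
    ClientState L M → ServiceClass → ℝ :=
  softPolicy ((m.iterates γ Kbar (Real.log (Fintype.card ServiceClass))
    ((1 - γ) / (N * √(T : ℝ))) (2 * N / ((1 - γ) * ξ)) t).1 n)

end StreamingModel

/-! Two online-learning regrets are played against each other.

Primal side. The score at `(s, a)` is supported on coordinate `s`, so the Fisher matrix is diagonal
and its Moore-Penrose inverse acts entrywise. At visited states the visit count and the product of
the two action probabilities cancel, and the natural gradient is the gap of the two action values
over `1 - γ` (`naturalGradient_apply`). The update is therefore exponential weights in each state.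
Soft-threshold policies are fully mixed, so all visit the same states, and no occupancy measure
charges any other state. Summing the exponential-weights identity along an occupancy measure, with
the performance difference lemma and monotone policy improvement, bounds the Lagrangian regret
(`naturalGradient_regret`). The multiplier changes between steps, which costs only its increments,
of size at most `1 / √T`.

The comparator is an arbitrary occupancy measure, not a policy. This handles a centralized Slater
policy: clients move independently given the joint action, so its marginals are occupancy measures
of the single clients (`isOccupancy_marginal`), whatever the correlation of the actions.

Dual side. Projected gradient ascent has regret of order `√T` (`projected_ascent_regret`). Against
multiplier `0`, and with a feasible comparator on the primal side, this gives the optimality gap.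

Violation. Strong duality is not needed. The iterates and the Slater point can be mixed so that the
constraint holds with equality; averaging primal regrets against this mixture bounds the Lagrangian
surplus by a multiple of the violation (`violation_mul_le`). The endpoint of `Λ` is twice that
multiple, so the dual regret against it leaves a positive coefficient on the violation. -/

/-! ### Occupancy measures of finite discounted Markov decision processes -/

section MeanCost

variable {S A : Type*} [Fintype S]

/-- The expected stage cost given the state and the action. -/
def meanCost (p : S → A → S → ℝ) (k : S → A → S → ℝ) (s : S) (a : A) : ℝ :=
  ∑ s', p s a s' * k s a s'

theorem meanCost_mem_Icc {p : S → A → S → ℝ} (hp : ∀ s a, p s a ∈ stdSimplex ℝ S)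
    {k : S → A → S → ℝ}
    (hk : ∀ s a s', k s a s' ∈ Set.Icc (0 : ℝ) 1) (s : S) (a : A) :
    meanCost p k s a ∈ Set.Icc (0 : ℝ) 1 := by
  constructor
  · exact Finset.sum_nonneg fun s' _ => mul_nonneg ((hp s a).1 s') (hk s a s').1
  · rw [← (hp s a).2]
    exact Finset.sum_le_sum fun s' _ => mul_le_of_le_one_right ((hp s a).1 s') (hk s a s').2

theorem meanCost_of_forall_eq {p : S → A → S → ℝ} (hp : ∀ s a, p s a ∈ stdSimplex ℝ S)
    (f : S → A → ℝ) (s : S) (a : A) : meanCost p (fun s a _ => f s a) s a = f s a := by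
  rw [meanCost, ← Finset.sum_mul, (hp s a).2, one_mul]

end MeanCost

section Occupancy

variable {S A : Type*} [Fintype S] [Fintype A]

/-- `ν` is an (unnormalized) discounted occupancy measure on state-action pairs: it is nonnegative
and satisfies the discounted flow balance for the initial law `ρ`. -/
structure IsOccupancy (γ : ℝ) (p : S → A → S → ℝ) (ρ : S → ℝ) (ν : S → A → ℝ) : Prop where
  nonneg : ∀ s a, 0 ≤ ν s a
  balance : ∀ s', ∑ a, ν s' a = ρ s' + γ * ∑ s, ∑ a, ν s a * p s a s'

/-- The discounted expected number of visits to a state. -/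
noncomputable def visitCount (γ : ℝ) (p : S → A → S → ℝ) (π : S → A → ℝ) (ρ : S → ℝ) (s : S) : ℝ :=
  ∑' t : ℕ, γ ^ t * stateLaw p π ρ t s

/-- The occupancy measure of a policy. -/
noncomputable def occupancy (γ : ℝ) (p : S → A → S → ℝ) (π : S → A → ℝ) (ρ : S → ℝ)
    (s : S) (a : A) : ℝ :=
  visitCount γ p π ρ s * π s a

/-- The state-action value obtained from the stage cost `r` and the state values `V`. -/
def qValue (γ : ℝ) (p : S → A → S → ℝ) (r : S → A → ℝ) (V : S → ℝ) (s : S) (a : A) : ℝ :=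
  r s a + γ * ∑ s', p s a s' * V s'

/-- The Bellman evaluation equation. -/
def IsValue (γ : ℝ) (p : S → A → S → ℝ) (π : S → A → ℝ) (r : S → A → ℝ) (V : S → ℝ) : Prop :=
  ∀ s, V s = ∑ a, π s a * qValue γ p r V s a

variable {γ : ℝ} {p : S → A → S → ℝ} {π : S → A → ℝ} {ρ : S → ℝ} {ν : S → A → ℝ}

theorem stateLaw_mem (hp : ∀ s a, p s a ∈ stdSimplex ℝ S) (hπ : IsPolicy π)
    (hρ : ρ ∈ stdSimplex ℝ S) (t : ℕ) : stateLaw p π ρ t ∈ stdSimplex ℝ S := by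
  induction t with
  | zero => exact hρ
  | succ t ih =>
    refine ⟨fun s' => Finset.sum_nonneg fun s _ => Finset.sum_nonneg fun a _ =>
      mul_nonneg (mul_nonneg (ih.1 s) ((hπ s).1 a)) ((hp s a).1 s'), ?_⟩
    calc ∑ s', ∑ s, ∑ a, stateLaw p π ρ t s * π s a * p s a s'
        = ∑ s, ∑ a, ∑ s', stateLaw p π ρ t s * π s a * p s a s' := by
          rw [Finset.sum_comm]
          exact Finset.sum_congr rfl fun s _ => Finset.sum_comm
      _ = ∑ s, stateLaw p π ρ t s := by
          refine Finset.sum_congr rfl fun s _ => ?_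
          simp_rw [← Finset.mul_sum, (hp s _).2, mul_one, ← Finset.mul_sum, (hπ s).2, mul_one]
      _ = 1 := ih.2

theorem stateLaw_le_one (hp : ∀ s a, p s a ∈ stdSimplex ℝ S) (hπ : IsPolicy π)
    (hρ : ρ ∈ stdSimplex ℝ S) (t : ℕ) (s : S) : stateLaw p π ρ t s ≤ 1 := by
  have h := stateLaw_mem hp hπ hρ t
  rw [← h.2]
  exact Finset.single_le_sum (fun i _ => h.1 i) (Finset.mem_univ s)

theorem norm_discounted_stateLaw_le (hγ0 : 0 ≤ γ) (hp : ∀ s a, p s a ∈ stdSimplex ℝ S)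
    (hπ : IsPolicy π) (hρ : ρ ∈ stdSimplex ℝ S) (t : ℕ) (s : S) :
    ‖γ ^ t * stateLaw p π ρ t s‖ ≤ γ ^ t := by
  rw [Real.norm_of_nonneg (mul_nonneg (pow_nonneg hγ0 t) ((stateLaw_mem hp hπ hρ t).1 s))]
  exact mul_le_of_le_one_right (pow_nonneg hγ0 t) (stateLaw_le_one hp hπ hρ t s)

theorem hasSum_visitCount (hγ0 : 0 ≤ γ) (hγ1 : γ < 1) (hp : ∀ s a, p s a ∈ stdSimplex ℝ S)
    (hπ : IsPolicy π) (hρ : ρ ∈ stdSimplex ℝ S) (s : S) :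
    HasSum (fun t => γ ^ t * stateLaw p π ρ t s) (visitCount γ p π ρ s) :=
  (Summable.of_norm_bounded (summable_geometric_of_lt_one hγ0 hγ1)
    (norm_discounted_stateLaw_le hγ0 hp hπ hρ · s)).hasSum

theorem visitCount_nonneg (hγ0 : 0 ≤ γ) (hp : ∀ s a, p s a ∈ stdSimplex ℝ S)
    (hπ : IsPolicy π) (hρ : ρ ∈ stdSimplex ℝ S) (s : S) : 0 ≤ visitCount γ p π ρ s :=
  tsum_nonneg fun t => mul_nonneg (pow_nonneg hγ0 t) ((stateLaw_mem hp hπ hρ t).1 s)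

theorem sum_occupancy (hπ : IsPolicy π) (s : S) :
    ∑ a, occupancy γ p π ρ s a = visitCount γ p π ρ s := by
  simp_rw [occupancy, ← Finset.mul_sum, (hπ s).2, mul_one]

theorem isOccupancy_occupancy (hγ0 : 0 ≤ γ) (hγ1 : γ < 1) (hp : ∀ s a, p s a ∈ stdSimplex ℝ S)
    (hπ : IsPolicy π) (hρ : ρ ∈ stdSimplex ℝ S) :
    IsOccupancy γ p ρ (occupancy γ p π ρ) := by
  refine ⟨fun s a => mul_nonneg (visitCount_nonneg hγ0 hp hπ hρ s) ((hπ s).1 a), fun s' => ?_⟩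
  rw [sum_occupancy hπ, visitCount,
    (hasSum_visitCount hγ0 hγ1 hp hπ hρ s').summable.tsum_eq_zero_add]
  congr 1
  · simp [stateLaw]
  · have h : HasSum (fun t => ∑ s, ∑ a, γ ^ t * stateLaw p π ρ t s * (π s a * p s a s'))
        (∑ s, ∑ a, visitCount γ p π ρ s * (π s a * p s a s')) :=
      hasSum_sum fun s _ => hasSum_sum fun a _ =>
        (hasSum_visitCount hγ0 hγ1 hp hπ hρ s).mul_right _
    have h2 := (h.mul_left γ).tsum_eq
    simp only [occupancy, mul_assoc] at h2 ⊢
    rw [← h2]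
    refine tsum_congr fun t => ?_
    simp only [stateLaw, Finset.mul_sum, pow_succ]
    refine Finset.sum_congr rfl fun s _ => Finset.sum_congr rfl fun a _ => ?_
    ring

theorem discountedCost_eq_sum_occupancy (hγ0 : 0 ≤ γ) (hγ1 : γ < 1)
    (hp : ∀ s a, p s a ∈ stdSimplex ℝ S) (hπ : IsPolicy π) (hρ : ρ ∈ stdSimplex ℝ S)
    (k : S → A → S → ℝ) :
    discountedCost γ p π ρ k = ∑ s, ∑ a, occupancy γ p π ρ s a * meanCost p k s a := by
  have h : HasSum (fun t => ∑ s, ∑ a, γ ^ t * stateLaw p π ρ t s * (π s a * meanCost p k s a))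
      (∑ s, ∑ a, visitCount γ p π ρ s * (π s a * meanCost p k s a)) :=
    hasSum_sum fun s _ => hasSum_sum fun a _ =>
      (hasSum_visitCount hγ0 hγ1 hp hπ hρ s).mul_right _
  simp only [occupancy, mul_assoc] at h ⊢
  rw [← h.tsum_eq]
  refine tsum_congr fun t => ?_
  simp only [expectedStageCost, Finset.mul_sum, meanCost]
  refine Finset.sum_congr rfl fun s _ => Finset.sum_congr rfl fun a _ =>
    Finset.sum_congr rfl fun s' _ => ?_
  ring

theorem visitation_eq (s : S) : visitation γ p π ρ s = (1 - γ) * visitCount γ p π ρ s := rfl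

theorem IsOccupancy.sum_eq (h : IsOccupancy γ p ρ ν) (hγ1 : γ < 1)
    (hp : ∀ s a, p s a ∈ stdSimplex ℝ S) (hρ : ρ ∈ stdSimplex ℝ S) :
    ∑ s, ∑ a, ν s a = 1 / (1 - γ) := by
  have h1 : ∑ s, ∑ a, ν s a = 1 + γ * ∑ s, ∑ a, ν s a := by
    calc ∑ s, ∑ a, ν s a = ∑ s', (ρ s' + γ * ∑ s, ∑ a, ν s a * p s a s') :=
          Finset.sum_congr rfl fun s _ => h.balance s
      _ = 1 + γ * ∑ s, ∑ a, ∑ s', ν s a * p s a s' := by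
          rw [Finset.sum_add_distrib, hρ.2, ← Finset.mul_sum, Finset.sum_comm]
          congr 2
          exact Finset.sum_congr rfl fun s _ => Finset.sum_comm
      _ = _ := by simp_rw [← Finset.mul_sum, (hp _ _).2, mul_one]
  rw [eq_div_iff (by linarith)]
  linarith

/-- The performance difference lemma for occupancy measures. -/
theorem IsOccupancy.sum_advantage (h : IsOccupancy γ p ρ ν) (r : S → A → ℝ) (V : S → ℝ) :
    ∑ s, ∑ a, ν s a * (qValue γ p r V s a - V s)
      = ∑ s, ∑ a, ν s a * r s a - ∑ s, ρ s * V s := by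
  -- The flow balance tested against `V`; no relation between `V` and a policy is used.
  have h1 : ∑ s, (∑ a, ν s a) * V s
      = ∑ s, ρ s * V s + ∑ s, ∑ a, ν s a * (γ * ∑ s', p s a s' * V s') := by
    simp_rw [h.balance, add_mul, Finset.sum_add_distrib]
    congr 1
    simp_rw [Finset.mul_sum, Finset.sum_mul]
    rw [Finset.sum_comm]
    refine Finset.sum_congr rfl fun s _ => ?_
    rw [Finset.sum_comm]
    refine Finset.sum_congr rfl fun a _ => Finset.sum_congr rfl fun s' _ => ?_
    ring
  simp_rw [qValue, mul_sub, mul_add, Finset.sum_sub_distrib, Finset.sum_add_distrib,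
    ← Finset.sum_mul]
  rw [h1]
  ring

/-- States not visited by a fully mixed occupancy measure are not visited by any other. -/
theorem IsOccupancy.eq_zero_of_not_visited {ν' : S → A → ℝ} (h : IsOccupancy γ p ρ ν)
    (h' : IsOccupancy γ p ρ ν') (hγ0 : 0 ≤ γ) (hγ1 : γ < 1)
    (hp : ∀ s a, p s a ∈ stdSimplex ℝ S) (hρ : ρ ∈ stdSimplex ℝ S)
    (hmix : ∀ s, ∑ a, ν s a ≠ 0 → ∀ a, 0 < ν s a) {s : S} (hs : ∑ a, ν s a = 0) (a : A) :
    ν' s a = 0 := by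
  classical
  set Z : Finset S := Finset.univ.filter fun s => ∑ a, ν s a = 0 with hZ
  -- Zero mass at `s'` makes every nonnegative inflow term vanish. The factor `γ` stays so that `γ =
  -- 0` is covered.
  have hflow : ∀ s' ∈ Z, ρ s' = 0 ∧ ∀ s ∉ Z, ∀ a, γ * p s a s' = 0 := by
    intro s' hs'
    have h0 : ∑ a, ν s' a = 0 := (Finset.mem_filter.1 hs').2
    rw [h.balance s', Finset.mul_sum] at h0
    have hterm : ∀ s a, 0 ≤ ν s a * p s a s' := fun s a =>
      mul_nonneg (h.nonneg s a) ((hp s a).1 s')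
    have hterm' : ∀ s, 0 ≤ γ * ∑ a, ν s a * p s a s' := fun s =>
      mul_nonneg hγ0 (Finset.sum_nonneg fun a _ => hterm s a)
    have hsum : 0 ≤ ∑ s, γ * ∑ a, ν s a * p s a s' := Finset.sum_nonneg fun s _ => hterm' s
    have hρ0 := hρ.1 s'
    refine ⟨by linarith, fun s hs a => ?_⟩
    have h1 : ∑ s, γ * ∑ a, ν s a * p s a s' = 0 := by linarith
    have h2 := (Finset.sum_eq_zero_iff_of_nonneg fun s _ => hterm' s).1 h1 s (Finset.mem_univ s)
    have hpos : 0 < ν s a := hmix s (fun h => hs (by simp [hZ, h])) a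
    rcases mul_eq_zero.1 h2 with h3 | h3
    · simp [h3]
    · have h4 := (Finset.sum_eq_zero_iff_of_nonneg fun a _ => hterm s a).1 h3 a (Finset.mem_univ a)
      rcases mul_eq_zero.1 h4 with h5 | h5
      · exact absurd h5 hpos.ne'
      · simp [h5]
  -- `Z` receives no initial mass and no flow from outside, so the mass of `ν'` on `Z` is at most
  -- `γ` times itself, hence zero.
  have hle : ∑ s' ∈ Z, ∑ a, ν' s' a ≤ γ * ∑ s ∈ Z, ∑ a, ν' s a := by
    calc ∑ s' ∈ Z, ∑ a, ν' s' a = ∑ s' ∈ Z, ∑ s, ∑ a, ν' s a * (γ * p s a s') := by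
          refine Finset.sum_congr rfl fun s' hs' => ?_
          rw [h'.balance s', (hflow s' hs').1, zero_add, Finset.mul_sum]
          refine Finset.sum_congr rfl fun s _ => ?_
          rw [Finset.mul_sum]
          exact Finset.sum_congr rfl fun a _ => by ring
      _ = ∑ s' ∈ Z, ∑ s ∈ Z, ∑ a, ν' s a * (γ * p s a s') := by
          refine Finset.sum_congr rfl fun s' hs' => ?_
          refine (Finset.sum_subset (Finset.subset_univ Z) fun s _ hs => ?_).symm
          exact Finset.sum_eq_zero fun a _ => by rw [(hflow s' hs').2 s hs a, mul_zero]
      _ = ∑ s ∈ Z, ∑ a, ν' s a * (γ * ∑ s' ∈ Z, p s a s') := by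
          rw [Finset.sum_comm]
          refine Finset.sum_congr rfl fun s _ => ?_
          rw [Finset.sum_comm]
          simp_rw [Finset.mul_sum]
      _ ≤ ∑ s ∈ Z, ∑ a, ν' s a * γ := by
          refine Finset.sum_le_sum fun s _ => Finset.sum_le_sum fun a _ => ?_
          refine mul_le_mul_of_nonneg_left ?_ (h'.nonneg s a)
          refine mul_le_of_le_one_right hγ0 ?_
          rw [← (hp s a).2]
          exact Finset.sum_le_univ_sum_of_nonneg (hp s a).1
      _ = _ := by simp_rw [Finset.mul_sum, mul_comm γ]
  have hnn : ∀ s, 0 ≤ ∑ a, ν' s a := fun s => Finset.sum_nonneg fun a _ => h'.nonneg s a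
  have hZ0 : 0 ≤ ∑ s ∈ Z, ∑ a, ν' s a := Finset.sum_nonneg fun s _ => hnn s
  have hZ1 : ∑ s ∈ Z, ∑ a, ν' s a = 0 := by nlinarith
  have hsZ := (Finset.sum_eq_zero_iff_of_nonneg fun s _ => hnn s).1 hZ1 s (by simp [hZ, hs])
  exact (Finset.sum_eq_zero_iff_of_nonneg fun a _ => h'.nonneg s a).1 hsZ a (Finset.mem_univ a)

/-- A positive entry of `ν` with a possible discounted transition would put mass on the target. This
makes the visited states of a fully mixed policy a closed set for the maximum principle. -/
theorem IsOccupancy.closed (h : IsOccupancy γ p ρ ν) (hγ0 : 0 ≤ γ)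
    (hp : ∀ s a, p s a ∈ stdSimplex ℝ S) (hρ : ρ ∈ stdSimplex ℝ S)
    {s s' : S} {a : A} (ha : 0 < ν s a) (hs' : ∑ a, ν s' a = 0) : γ * p s a s' = 0 := by
  rw [h.balance s'] at hs'
  have hterm : ∀ s a, 0 ≤ ν s a * p s a s' := fun s a => mul_nonneg (h.nonneg s a) ((hp s a).1 s')
  have h1 : ν s a * p s a s' ≤ ∑ s, ∑ a, ν s a * p s a s' :=
    (Finset.single_le_sum (fun a _ => hterm s a) (Finset.mem_univ a)).trans
      (Finset.single_le_sum (f := fun s => ∑ a, ν s a * p s a s')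
        (fun s _ => Finset.sum_nonneg fun a _ => hterm s a) (Finset.mem_univ s))
  have h2 : γ * (ν s a * p s a s') = 0 :=
    le_antisymm (by nlinarith [hρ.1 s', mul_le_mul_of_nonneg_left h1 hγ0])
      (mul_nonneg hγ0 (hterm s a))
  rcases mul_eq_zero.1 h2 with h3 | h3
  · simp [h3]
  · rcases mul_eq_zero.1 h3 with h4 | h4
    · exact absurd h4 ha.ne'
    · simp [h4]

/-! ### Maximum principle and value functions -/

/-- The maximum principle for the discounted evaluation operator, on a closed set of states. -/
theorem nonpos_of_le_discounted (hγ0 : 0 ≤ γ) (hγ1 : γ < 1)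
    (hp : ∀ s a, p s a ∈ stdSimplex ℝ S) (hπ : IsPolicy π) (R : Set S)
    (hR : ∀ s ∈ R, ∀ a, ∀ s' ∉ R, γ * p s a s' = 0) (f : S → ℝ)
    (hf : ∀ s ∈ R, f s ≤ ∑ a, π s a * (γ * ∑ s', p s a s' * f s')) :
    ∀ s ∈ R, f s ≤ 0 := by
  classical
  by_contra! hcon
  obtain ⟨s₀, hs₀, hf₀⟩ := hcon
  -- At a maximizer over `R` a positive value would satisfy `f s₁ ≤ γ * f s₁`.
  obtain ⟨s₁, hs₁, hmax⟩ := Finset.exists_max_image (Finset.univ.filter (· ∈ R)) f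
    ⟨s₀, by simp [hs₀]⟩
  simp only [Finset.mem_filter, Finset.mem_univ, true_and] at hs₁ hmax
  have hpos : 0 < f s₁ := hf₀.trans_le (hmax s₀ hs₀)
  have hle : f s₁ ≤ γ * f s₁ := by
    calc f s₁ ≤ ∑ a, π s₁ a * (γ * ∑ s', p s₁ a s' * f s') := hf s₁ hs₁
      _ ≤ ∑ a, π s₁ a * (γ * f s₁) := by
          refine Finset.sum_le_sum fun a _ => mul_le_mul_of_nonneg_left ?_ ((hπ s₁).1 a)
          calc γ * ∑ s', p s₁ a s' * f s' = ∑ s', γ * p s₁ a s' * f s' := by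
                simp_rw [Finset.mul_sum, mul_assoc]
            _ ≤ ∑ s', γ * p s₁ a s' * f s₁ := by
                refine Finset.sum_le_sum fun s' _ => ?_
                by_cases hs' : s' ∈ R
                · exact mul_le_mul_of_nonneg_left (hmax s' hs')
                    (mul_nonneg hγ0 ((hp s₁ a).1 s'))
                · simp [hR s₁ hs₁ a s' hs']
            _ = γ * f s₁ := by rw [← Finset.sum_mul, ← Finset.mul_sum, (hp s₁ a).2, mul_one]
      _ = γ * f s₁ := by rw [← Finset.sum_mul, (hπ s₁).2, one_mul]
  nlinarith

/-- The maximum principle applied to `V` and `-V` makes the Bellman operator injective, hence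
surjective in finite dimension. -/
theorem exists_isValue (hγ0 : 0 ≤ γ) (hγ1 : γ < 1) (hp : ∀ s a, p s a ∈ stdSimplex ℝ S)
    (hπ : IsPolicy π) (r : S → A → ℝ) : ∃ V, IsValue γ p π r V := by
  let B : (S → ℝ) →ₗ[ℝ] (S → ℝ) :=
    { toFun := fun V s => V s - ∑ a, π s a * (γ * ∑ s', p s a s' * V s')
      map_add' := fun V W => by
        funext s
        simp only [Pi.add_apply, mul_add, Finset.sum_add_distrib]
        ring
      map_smul' := fun c V => by
        funext s
        simp only [Pi.smul_apply, smul_eq_mul, RingHom.id_apply, mul_sub, Finset.mul_sum]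
        congr 1
        exact Finset.sum_congr rfl fun a _ => Finset.sum_congr rfl fun s' _ => by ring }
  have hB : ∀ V s, B V s = V s - ∑ a, π s a * (γ * ∑ s', p s a s' * V s') := fun V s => rfl
  have hnonpos : ∀ V, B V = 0 → ∀ s, V s ≤ 0 := fun V hV s =>
    nonpos_of_le_discounted hγ0 hγ1 hp hπ Set.univ (by simp) V
      (fun s _ => by have := congrFun hV s; rw [hB] at this; simp at this; linarith) s trivial
  have hinj : Function.Injective B := by
    refine (injective_iff_map_eq_zero B).2 fun V hV => funext fun s => ?_
    have h1 := hnonpos V hV s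
    have h2 := hnonpos (-V) (by rw [map_neg, hV, neg_zero]) s
    simp at h1 h2 ⊢
    linarith
  obtain ⟨V, hV⟩ := LinearMap.injective_iff_surjective.1 hinj fun s => ∑ a, π s a * r s a
  refine ⟨V, fun s => ?_⟩
  have := congrFun hV s
  rw [hB] at this
  simp_rw [qValue, mul_add, Finset.sum_add_distrib]
  linarith

/-- The maximum principle applied to `-V` and to `V - 1 / (1 - γ)`, both written in the affine form
handled by `hconst`. -/
theorem IsValue.mem_Icc {r : S → A → ℝ} {V : S → ℝ} (hV : IsValue γ p π r V) (hγ0 : 0 ≤ γ)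
    (hγ1 : γ < 1) (hp : ∀ s a, p s a ∈ stdSimplex ℝ S) (hπ : IsPolicy π)
    (hr : ∀ s a, r s a ∈ Set.Icc (0 : ℝ) 1) (s : S) : V s ∈ Set.Icc (0 : ℝ) (1 / (1 - γ)) := by
  have hconst : ∀ (s : S) (a : A) (f : S → ℝ) (x y : ℝ),
      ∑ s', p s a s' * (x * f s' + y) = x * (∑ s', p s a s' * f s') + y := by
    intro s a f x y
    simp_rw [mul_add, Finset.sum_add_distrib, ← Finset.sum_mul, (hp s a).2, one_mul,
      Finset.mul_sum]
    congr 1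
    exact Finset.sum_congr rfl fun s' _ => by ring
  have hγ : (1 - γ) ≠ 0 := by linarith
  constructor
  · have := nonpos_of_le_discounted hγ0 hγ1 hp hπ Set.univ (by simp) (fun s => -1 * V s + 0)
      (fun s _ => by
        rw [hV s, Finset.mul_sum, add_zero]
        refine Finset.sum_le_sum fun a _ => ?_
        rw [hconst, qValue]
        nlinarith [(hπ s).1 a, (hr s a).1, mul_nonneg ((hπ s).1 a) (hr s a).1]) s trivial
    simp at this
    exact this
  · have := nonpos_of_le_discounted hγ0 hγ1 hp hπ Set.univ (by simp)
      (fun s => 1 * V s + -(1 / (1 - γ))) (fun s _ => by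
        have h1 : -(1 / (1 - γ)) = ∑ a, π s a * -(1 / (1 - γ)) := by
          rw [← Finset.sum_mul, (hπ s).2, one_mul]
        rw [hV s, one_mul, h1, ← Finset.sum_add_distrib]
        refine Finset.sum_le_sum fun a _ => ?_
        rw [← mul_add]
        refine mul_le_mul_of_nonneg_left ?_ ((hπ s).1 a)
        rw [← h1, hconst, qValue]
        have h2 : γ * -(1 / (1 - γ)) = 1 + -(1 / (1 - γ)) := by field_simp; ring
        rw [mul_add, h2]
        linarith [(hr s a).2]) s trivial
    simp at this
    simpa using this

/-- A policy generating its occupancy measure has the expected total cost of its value function. -/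
theorem IsOccupancy.sum_cost_eq (h : IsOccupancy γ p ρ ν)
    (hν : ∀ s a, ν s a = (∑ b, ν s b) * π s a) (hπ : IsPolicy π) {r : S → A → ℝ} {V : S → ℝ}
    (hV : IsValue γ p π r V) : ∑ s, ∑ a, ν s a * r s a = ∑ s, ρ s * V s := by
  have h1 := h.sum_advantage r V
  have h2 : ∑ s, ∑ a, ν s a * (qValue γ p r V s a - V s) = 0 := by
    refine Finset.sum_eq_zero fun s _ => ?_
    have h3 : ∀ a, ν s a * (qValue γ p r V s a - V s)
        = (∑ b, ν s b) * (π s a * qValue γ p r V s a - π s a * V s) := fun a => by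
      rw [hν s a]; ring
    simp_rw [h3]
    rw [← Finset.mul_sum, Finset.sum_sub_distrib, ← hV s, ← Finset.sum_mul, (hπ s).2]
    ring
  linarith

theorem discountedCost_eq_sum_value (hγ0 : 0 ≤ γ) (hγ1 : γ < 1)
    (hp : ∀ s a, p s a ∈ stdSimplex ℝ S) (hπ : IsPolicy π) (hρ : ρ ∈ stdSimplex ℝ S)
    {k : S → A → S → ℝ} {V : S → ℝ} (hV : IsValue γ p π (meanCost p k) V) :
    discountedCost γ p π ρ k = ∑ s, ρ s * V s := by
  rw [discountedCost_eq_sum_occupancy hγ0 hγ1 hp hπ hρ]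
  exact (isOccupancy_occupancy hγ0 hγ1 hp hπ hρ).sum_cost_eq
    (fun s a => by rw [sum_occupancy hπ]; rfl) hπ hV

theorem IsOccupancy.sum_cost_mem_Icc (h : IsOccupancy γ p ρ ν) (hγ1 : γ < 1)
    (hp : ∀ s a, p s a ∈ stdSimplex ℝ S) (hρ : ρ ∈ stdSimplex ℝ S) {r : S → A → ℝ}
    (hr : ∀ s a, r s a ∈ Set.Icc (0 : ℝ) 1) :
    ∑ s, ∑ a, ν s a * r s a ∈ Set.Icc (0 : ℝ) (1 / (1 - γ)) := by
  rw [← h.sum_eq hγ1 hp hρ]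
  exact ⟨Finset.sum_nonneg fun s _ => Finset.sum_nonneg fun a _ =>
      mul_nonneg (h.nonneg s a) (hr s a).1,
    Finset.sum_le_sum fun s _ => Finset.sum_le_sum fun a _ =>
      mul_le_of_le_one_right (h.nonneg s a) (hr s a).2⟩

/-- Finite-time laws are polynomial in the policy, and the geometric majorant is uniform in it. -/
theorem continuous_visitCount {X : Type*} [TopologicalSpace X] {φ : X → S → A → ℝ}
    (hγ0 : 0 ≤ γ) (hγ1 : γ < 1) (hp : ∀ s a, p s a ∈ stdSimplex ℝ S)
    (hρ : ρ ∈ stdSimplex ℝ S) (hφ : ∀ x, IsPolicy (φ x))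
    (hcont : ∀ s a, Continuous fun x => φ x s a) (s : S) :
    Continuous fun x => visitCount γ p (φ x) ρ s := by
  have hlaw : ∀ t s, Continuous fun x => stateLaw p (φ x) ρ t s := by
    intro t
    induction t with
    | zero => exact fun s => continuous_const
    | succ t ih =>
      intro s'
      exact continuous_finsetSum _ fun s _ => continuous_finsetSum _ fun a _ =>
        ((ih s).mul (hcont s a)).mul continuous_const
  exact continuous_tsum (fun t => continuous_const.mul (hlaw t s))
    (summable_geometric_of_lt_one hγ0 hγ1)
    (fun t x => norm_discounted_stateLaw_le hγ0 hp (hφ x) hρ t s)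

end Occupancy

/-! ### Marginal occupancy measures of the clients -/

section Marginal

/-- Attach `f` to the `n`-th factor and expand the product of sums; the other factors sum to one. -/
theorem sum_prod_mul_apply {ι X : Type*} [Fintype ι] [DecidableEq ι] [Fintype X]
    (q : ι → X → ℝ) (hq : ∀ i, ∑ x, q i x = 1) (n : ι) (f : X → ℝ) :
    ∑ a : ι → X, (∏ i, q i (a i)) * f (a n) = ∑ x, q n x * f x := by
  have h := Finset.prod_univ_sum (fun _ : ι => (Finset.univ : Finset X))
    (fun i x => q i x * if i = n then f x else 1)
  rw [Fintype.piFinset_univ] at h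
  simp_rw [Finset.prod_mul_distrib, Finset.prod_ite_eq' Finset.univ n, Finset.mem_univ,
    if_true] at h
  rw [← h, ← Finset.mul_prod_erase _ _ (Finset.mem_univ n), Finset.prod_eq_one, mul_one]
  · simp
  · intro i hi
    simp [Finset.ne_of_mem_erase hi, hq]

theorem prod_mem_stdSimplex {ι X : Type*} [Fintype ι] [DecidableEq ι] [Fintype X]
    (q : ι → X → ℝ) (hq : ∀ i, q i ∈ stdSimplex ℝ X) :
    (fun a : ι → X => ∏ i, q i (a i)) ∈ stdSimplex ℝ (ι → X) := by
  refine ⟨fun a => Finset.prod_nonneg fun i _ => (hq i).1 (a i), ?_⟩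
  have h := Finset.prod_univ_sum (fun _ : ι => (Finset.univ : Finset X)) q
  rw [Fintype.piFinset_univ] at h
  rw [← h]
  exact Finset.prod_eq_one fun i _ => (hq i).2

/-- The marginal on coordinate `n` of a measure on joint states and joint actions. -/
def marginal {ι X Y : Type*} [Fintype ι] [DecidableEq ι] [Fintype X] [DecidableEq X] [Fintype Y]
    [DecidableEq Y] (ν : (ι → X) → (ι → Y) → ℝ) (n : ι) (x : X) (y : Y) : ℝ :=
  ∑ s, ∑ a, ν s a * if s n = x ∧ a n = y then 1 else 0

theorem sum_marginal_mul {ι X Y : Type*} [Fintype ι] [DecidableEq ι] [Fintype X] [DecidableEq X]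
    [Fintype Y] [DecidableEq Y] (ν : (ι → X) → (ι → Y) → ℝ) (n : ι) (f : X → Y → ℝ) :
    ∑ x, ∑ y, marginal ν n x y * f x y = ∑ s, ∑ a, ν s a * f (s n) (a n) := by
  simp_rw [marginal, Finset.sum_mul]
  calc ∑ x, ∑ y, ∑ s, ∑ a, (ν s a * if s n = x ∧ a n = y then 1 else 0) * f x y
      = ∑ s, ∑ a, ∑ x, ∑ y, (ν s a * if s n = x ∧ a n = y then 1 else 0) * f x y := by
        trans ∑ x, ∑ s, ∑ a, ∑ y, (ν s a * if s n = x ∧ a n = y then 1 else 0) * f x y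
        · refine Finset.sum_congr rfl fun x _ => ?_
          rw [Finset.sum_comm]
          exact Finset.sum_congr rfl fun s _ => Finset.sum_comm
        · rw [Finset.sum_comm]
          exact Finset.sum_congr rfl fun s _ => Finset.sum_comm
    _ = _ := by
        refine Finset.sum_congr rfl fun s _ => Finset.sum_congr rfl fun a _ => ?_
        simp_rw [mul_assoc, ← Finset.mul_sum, ite_and, ite_mul, one_mul, zero_mul]
        simp

end Marginal

namespace StreamingModel

variable {N L M : ℕ} (m : StreamingModel N L M)

theorem trans_mem (n : Fin N) (s : ClientState L M) (a : ServiceClass) :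
    m.trans n s a ∈ stdSimplex ℝ (ClientState L M) := by
  obtain ⟨hα0, hα1⟩ := m.α_mem
  obtain ⟨hβ0, hβ1⟩ := m.β_mem n
  obtain ⟨hμ0, hμ1⟩ := m.μ_mem n a
  have hα : 0 ≤ 1 - m.α := by linarith
  have hup : 0 ≤ m.probUp n a := mul_nonneg hμ0 (by linarith)
  have hdown : 0 ≤ m.probDown n a := mul_nonneg (by linarith) hβ0
  have hstay : 0 ≤ m.probStay n a := by
    have : m.probStay n a = m.μ n a * m.β n + (1 - m.μ n a) * (1 - m.β n) := by
      simp only [probStay, probUp, probDown]; ring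
    rw [this]
    exact add_nonneg (mul_nonneg hμ0 hβ0) (mul_nonneg (by linarith) (by linarith))
  constructor
  · intro s'
    have hite : ∀ q : Prop, [Decidable q] → (0 : ℝ) ≤ if q then 1 else 0 := fun q _ => by
      split_ifs <;> norm_num
    exact add_nonneg (add_nonneg (add_nonneg
      (mul_nonneg (mul_nonneg hα hstay) (hite _)) (mul_nonneg (mul_nonneg hα hup) (hite _)))
      (mul_nonneg (mul_nonneg hα hdown) (hite _))) (mul_nonneg hα0 (hite _))
  · simp only [trans, Finset.sum_add_distrib, ← Finset.mul_sum, Finset.sum_ite_eq',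
      Finset.mem_univ, if_true, probStay]
    ring

theorem jointTrans_mem (s : Fin N → ClientState L M) (a : Fin N → ServiceClass) :
    m.jointTrans s a ∈ stdSimplex ℝ (Fin N → ClientState L M) :=
  prod_mem_stdSimplex (fun n => m.trans n (s n) (a n)) fun n => m.trans_mem n (s n) (a n)

theorem jointInit_mem : m.jointInit ∈ stdSimplex ℝ (Fin N → ClientState L M) :=
  prod_mem_stdSimplex m.ρ m.ρ_mem

/-- The joint balance is tested against the indicator of the `n`-th coordinate. The joint kernel is
a product given the joint action, so summing out the other coordinates leaves the kernel of client
`n`; the form of the joint policy plays no role. -/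
theorem isOccupancy_marginal {γ : ℝ} {ν : (Fin N → ClientState L M) → (Fin N → ServiceClass) → ℝ}
    (h : IsOccupancy γ m.jointTrans m.jointInit ν) (n : Fin N) :
    IsOccupancy γ (m.trans n) (m.ρ n) (marginal ν n) := by
  refine ⟨fun x b => Finset.sum_nonneg fun s _ => Finset.sum_nonneg fun a _ =>
    mul_nonneg (h.nonneg s a) (by split_ifs <;> norm_num), fun x' => ?_⟩
  have h1 : ∑ b, marginal ν n x' b = ∑ x, ∑ b, marginal ν n x b * if x = x' then 1 else 0 := by
    simp_rw [mul_ite, mul_one, mul_zero]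
    rw [Finset.sum_comm]
    simp
  rw [h1, sum_marginal_mul ν n fun x _ => if x = x' then 1 else 0,
    sum_marginal_mul ν n fun x b => m.trans n x b x']
  simp_rw [← Finset.sum_mul, h.balance, add_mul, Finset.sum_add_distrib]
  congr 1
  · have := sum_prod_mul_apply m.ρ (fun i => (m.ρ_mem i).2) n fun x => if x = x' then 1 else 0
    simp only [jointInit]
    rw [this]
    simp
  · simp_rw [mul_assoc, ← Finset.mul_sum]
    congr 1
    simp_rw [Finset.sum_mul]
    rw [Finset.sum_comm]
    refine Finset.sum_congr rfl fun s _ => ?_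
    rw [Finset.sum_comm]
    refine Finset.sum_congr rfl fun a _ => ?_
    have := sum_prod_mul_apply (fun i => m.trans i (s i) (a i))
      (fun i => (m.trans_mem i (s i) (a i)).2) n fun x => if x = x' then 1 else 0
    simp_rw [mul_assoc, ← Finset.mul_sum, jointTrans]
    rw [this]
    simp

theorem jointJg_eq {γ : ℝ} (hγ0 : 0 ≤ γ) (hγ1 : γ < 1)
    {π : (Fin N → ClientState L M) → (Fin N → ServiceClass) → ℝ} (hπ : IsPolicy π) :
    m.jointJg γ π = ∑ n, ∑ x, ∑ b,
      marginal (occupancy γ m.jointTrans π m.jointInit) n x b * serviceCost b := by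
  rw [jointJg, discountedCost_eq_sum_occupancy hγ0 hγ1 m.jointTrans_mem hπ m.jointInit_mem]
  simp_rw [meanCost_of_forall_eq m.jointTrans_mem
    (fun _ (a : Fin N → ServiceClass) => ∑ n, serviceCost (a n)), sum_marginal_mul,
    Finset.mul_sum]
  symm
  rw [Finset.sum_comm]
  exact Finset.sum_congr rfl fun s _ => Finset.sum_comm

theorem isPolicy_productPolicy {π : Fin N → ClientState L M → ServiceClass → ℝ}
    (hπ : ∀ n, IsPolicy (π n)) : IsPolicy (productPolicy π) :=
  fun s => prod_mem_stdSimplex (fun n => π n (s n)) fun n => hπ n (s n)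

/-- The other clients' action probabilities sum to one in every joint state, so the conditional
action law of client `n` depends on its own state only. -/
theorem marginal_productPolicy {γ : ℝ} {π : Fin N → ClientState L M → ServiceClass → ℝ}
    (hπ : ∀ n, IsPolicy (π n)) (n : Fin N) (x : ClientState L M) (b : ServiceClass) :
    marginal (occupancy γ m.jointTrans (productPolicy π) m.jointInit) n x b
      = (∑ b', marginal (occupancy γ m.jointTrans (productPolicy π) m.jointInit) n x b')
        * π n x b := by
  have h : ∀ b, marginal (occupancy γ m.jointTrans (productPolicy π) m.jointInit) n x b
      = (∑ s, visitCount γ m.jointTrans (productPolicy π) m.jointInit s *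
          if s n = x then 1 else 0) * π n x b := by
    intro b
    rw [marginal, Finset.sum_mul]
    refine Finset.sum_congr rfl fun s _ => ?_
    have h1 := sum_prod_mul_apply (fun i => π i (s i)) (fun i => (hπ i (s i)).2) n
      fun y => if y = b then (1 : ℝ) else 0
    by_cases hs : s n = x
    · simp only [occupancy, hs, true_and, if_true, mul_one, mul_assoc, ← Finset.mul_sum,
        productPolicy]
      rw [h1]
      simp [hs]
    · simp [hs]
  simp_rw [h]
  rw [← Finset.mul_sum, (hπ n x).2, mul_one]

/-- The marginal is an occupancy measure generated by `π n`, so both sides equal the initial law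
paired with the value function. -/
theorem jointJg_productPolicy {γ : ℝ} (hγ0 : 0 ≤ γ) (hγ1 : γ < 1)
    {π : Fin N → ClientState L M → ServiceClass → ℝ} (hπ : ∀ n, IsPolicy (π n)) :
    m.jointJg γ (productPolicy π) = ∑ n, m.Jg γ n (π n) := by
  rw [m.jointJg_eq hγ0 hγ1 (isPolicy_productPolicy hπ)]
  refine Finset.sum_congr rfl fun n _ => ?_
  obtain ⟨V, hV⟩ := exists_isValue hγ0 hγ1 (m.trans_mem n) (hπ n)
    (meanCost (m.trans n) fun _ a _ => serviceCost a)
  rw [Jg, discountedCost_eq_sum_value hγ0 hγ1 (m.trans_mem n) (hπ n) (m.ρ_mem n) hV,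
    ← (m.isOccupancy_marginal (isOccupancy_occupancy hγ0 hγ1 m.jointTrans_mem
      (isPolicy_productPolicy hπ) m.jointInit_mem) n).sum_cost_eq
      (m.marginal_productPolicy hπ n) (hπ n) hV]
  simp_rw [meanCost_of_forall_eq (m.trans_mem n) fun _ a => serviceCost a]

end StreamingModel

/-! ### The soft-threshold policy and its natural gradient -/

/-- The two action probabilities of the soft-threshold policy with parameter value `x`. -/
noncomputable def softProb (x : ℝ) : ServiceClass → ℝ
  | ServiceClass.a₁ => 1 - 1 / (1 + Real.exp x)
  | ServiceClass.a₂ => 1 / (1 + Real.exp x)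

theorem sum_serviceClass {X : Type*} [AddCommMonoid X] (f : ServiceClass → X) :
    ∑ a, f a = f ServiceClass.a₁ + f ServiceClass.a₂ := by
  have : (Finset.univ : Finset ServiceClass) = {ServiceClass.a₁, ServiceClass.a₂} := rfl
  rw [this, Finset.sum_pair (by simp)]

theorem softProb_pos (x : ℝ) (a : ServiceClass) : 0 < softProb x a := by
  have h := Real.exp_pos x
  cases a
  · simp only [softProb]
    rw [sub_pos, div_lt_one (by positivity)]
    linarith
  · simp only [softProb]
    positivity

theorem sum_softProb (x : ℝ) : ∑ a, softProb x a = 1 := by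
  rw [sum_serviceClass]
  simp [softProb]

theorem log_softProb_zero (a : ServiceClass) : Real.log (softProb 0 a) = -Real.log 2 := by
  have : softProb 0 a = 2⁻¹ := by
    cases a <;> simp only [softProb, Real.exp_zero] <;> norm_num
  rw [this, Real.log_inv]

/-- The derivative of `softProb · a` divided by the product of both probabilities. -/
def actionSign : ServiceClass → ℝ
  | ServiceClass.a₁ => 1
  | ServiceClass.a₂ => -1

theorem hasDerivAt_softProb (x : ℝ) (a : ServiceClass) :
    HasDerivAt (fun y => softProb y a)
      (actionSign a * (softProb x ServiceClass.a₁ * softProb x ServiceClass.a₂)) x := by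
  have h0 : (1 + Real.exp x) ≠ 0 := by positivity
  have h := ((Real.hasDerivAt_exp x).const_add 1).fun_inv h0
  cases a
  · simp only [softProb, actionSign, one_div]
    refine (h.const_sub 1).congr_deriv ?_
    field_simp
    ring
  · simp only [softProb, actionSign, one_div]
    refine h.congr_deriv ?_
    field_simp
    ring

/-- One step of exponential weights on two actions. -/
theorem exists_log_partition (x κ : ℝ) (q : ServiceClass → ℝ) :
    ∃ l : ℝ, 0 ≤ l ∧
      (∀ a, κ * (q a - ∑ b, softProb x b * q b) = Real.log (softProb x a)
        - Real.log (softProb (x - κ * (q ServiceClass.a₁ - q ServiceClass.a₂)) a) - l) ∧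
      ∑ a, softProb (x - κ * (q ServiceClass.a₁ - q ServiceClass.a₂)) a *
        (κ * (q a - ∑ b, softProb x b * q b)) ≤ -l := by
  set v := ∑ b, softProb x b * q b with hv
  set x' := x - κ * (q ServiceClass.a₁ - q ServiceClass.a₂) with hx'
  set Z := ∑ a, softProb x a * Real.exp (-(κ * (q a - v))) with hZ
  -- `1 + y ≤ exp y`, where the linear terms average to zero because `v` is the mean of `q`.
  have hZ1 : 1 ≤ Z := by
    calc (1 : ℝ) = ∑ a, softProb x a * (-(κ * (q a - v)) + 1) := by
          have : ∀ a, softProb x a * (-(κ * (q a - v)) + 1)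
              = softProb x a + κ * v * softProb x a - κ * (softProb x a * q a) := fun a => by ring
          simp_rw [this, Finset.sum_sub_distrib, Finset.sum_add_distrib, ← Finset.mul_sum,
            sum_softProb, ← hv]
          ring
      _ ≤ Z := Finset.sum_le_sum fun a _ =>
          mul_le_mul_of_nonneg_left (Real.add_one_le_exp _) (softProb_pos x a).le
  have hZ0 : 0 < Z := by linarith
  have hstep : ∀ a, softProb x' a = softProb x a * Real.exp (-(κ * (q a - v))) / Z := by
    have e1 : Real.exp (-(κ * (q ServiceClass.a₁ - v)))
        = Real.exp (-(κ * (q ServiceClass.a₂ - v))) *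
          Real.exp (-(κ * (q ServiceClass.a₁ - q ServiceClass.a₂))) := by
      rw [← Real.exp_add]; congr 1; ring
    have e2 : Real.exp x' = Real.exp x *
        Real.exp (-(κ * (q ServiceClass.a₁ - q ServiceClass.a₂))) := by
      rw [← Real.exp_add]; congr 1
    have p0 := Real.exp_pos x
    have p1 := Real.exp_pos (-(κ * (q ServiceClass.a₂ - v)))
    have p2 := Real.exp_pos (-(κ * (q ServiceClass.a₁ - q ServiceClass.a₂)))
    have hZ' : Z = Real.exp (-(κ * (q ServiceClass.a₂ - v))) *
        (1 + Real.exp x * Real.exp (-(κ * (q ServiceClass.a₁ - q ServiceClass.a₂))))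
        / (1 + Real.exp x) := by
      rw [hZ, sum_serviceClass, e1]
      simp only [softProb]
      field_simp
      ring
    intro a
    rw [hZ']
    cases a <;> simp only [softProb, e1, e2] <;> field_simp
    ring
  have hlog : ∀ a, κ * (q a - v)
      = Real.log (softProb x a) - Real.log (softProb x' a) - Real.log Z := by
    intro a
    rw [hstep a, Real.log_div (mul_pos (softProb_pos x a) (Real.exp_pos _)).ne' hZ0.ne',
      Real.log_mul (softProb_pos x a).ne' (Real.exp_pos _).ne', Real.log_exp]
    ring
  refine ⟨Real.log Z, Real.log_nonneg hZ1, hlog, ?_⟩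
  -- Nonnegativity of the relative entropy of the new law to the old one, through `log y ≤ y - 1`.
  calc ∑ a, softProb x' a * (κ * (q a - v))
      ≤ ∑ a, (softProb x a - softProb x' a - softProb x' a * Real.log Z) := by
        refine Finset.sum_le_sum fun a _ => ?_
        have h1 := softProb_pos x a
        have h2 := softProb_pos x' a
        have h3 := Real.log_le_sub_one_of_pos (div_pos h1 h2)
        rw [Real.log_div h1.ne' h2.ne'] at h3
        have h4 := mul_le_mul_of_nonneg_left h3 h2.le
        have h5 : softProb x' a * (softProb x a / softProb x' a - 1)
            = softProb x a - softProb x' a := by field_simp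
        rw [hlog a]
        nlinarith
    _ = -Real.log Z := by
        simp_rw [Finset.sum_sub_distrib, ← Finset.sum_mul, sum_softProb]
        ring

theorem softPolicy_eq {L M : ℕ} (θ : EuclideanSpace ℝ (ClientState L M)) (s : ClientState L M)
    (a : ServiceClass) : softPolicy θ s a = softProb (θ s) a := by
  cases a <;> rfl

theorem isPolicy_softPolicy {L M : ℕ} (θ : EuclideanSpace ℝ (ClientState L M)) :
    IsPolicy (softPolicy θ) := by
  refine fun s => ⟨fun a => ?_, ?_⟩
  · rw [softPolicy_eq]; exact (softProb_pos _ a).le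
  · simp_rw [softPolicy_eq]; exact sum_softProb _

/-- A function of one coordinate has its gradient along that coordinate. -/
theorem hasGradientAt_comp_apply {ι : Type*} [Fintype ι] [DecidableEq ι] {f : ℝ → ℝ} {f' : ℝ}
    (θ : EuclideanSpace ℝ ι) (i : ι) (h : HasDerivAt f f' (θ i)) :
    HasGradientAt (fun θ' : EuclideanSpace ℝ ι => f (θ' i)) (EuclideanSpace.single i f') θ := by
  rw [hasGradientAt_iff_hasFDerivAt]
  have h1 := HasDerivAt.comp_hasFDerivAt (h₂ := f) (f := fun θ' : EuclideanSpace ℝ ι => θ' i) θ h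
    (EuclideanSpace.proj i : EuclideanSpace ℝ ι →L[ℝ] ℝ).hasFDerivAt
  refine h1.congr_fderiv ?_
  ext v
  simp [EuclideanSpace.inner_single_left]

theorem score_eq {L M : ℕ} (θ : EuclideanSpace ℝ (ClientState L M)) (s : ClientState L M)
    (a : ServiceClass) :
    score θ s a = EuclideanSpace.single s (actionSign a *
      (softProb (θ s) ServiceClass.a₁ * softProb (θ s) ServiceClass.a₂) / softProb (θ s) a) := by
  simp_rw [score, softPolicy_eq]
  exact (hasGradientAt_comp_apply θ s
    ((hasDerivAt_softProb (θ s) a).log (softProb_pos _ a).ne')).gradient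

/-- The product rule at a zero of the second factor: the first one need only be continuous. -/
theorem HasGradientAt.mul_of_eq_zero {E : Type*} [NormedAddCommGroup E] [InnerProductSpace ℝ E]
    [CompleteSpace E] {f g : E → ℝ} {x g' : E} (hg : HasGradientAt g g' x) (hg0 : g x = 0)
    (hf : ContinuousAt f x) : HasGradientAt (fun y => f y * g y) (f x • g') x := by
  rw [hasGradientAt_iff_isLittleO] at hg ⊢
  -- As `g x = 0`, the remainder is `f` times the remainder of `g` plus the increment of `f` times
  -- the linear part.
  have h1 : (fun y => f y * (g y - g x - inner ℝ g' (y - x))) =o[nhds x] fun y => y - x := by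
    simpa using (hf.isBigO_one ℝ).mul_isLittleO hg.norm_right
  have h2 : (fun y => (f y - f x) * inner ℝ g' (y - x)) =o[nhds x] fun y => y - x := by
    have h3 : (fun y => f y - f x) =o[nhds x] fun _ => (1 : ℝ) := by
      rw [Asymptotics.isLittleO_one_iff]
      simpa using hf.tendsto.sub_const (f x)
    have h4 : (fun y => inner ℝ g' (y - x)) =O[nhds x] fun y => ‖y - x‖ :=
      Asymptotics.IsBigO.of_bound ‖g'‖ (Filter.Eventually.of_forall fun y => by
        simpa using norm_inner_le_norm (𝕜 := ℝ) g' (y - x))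
    simpa using h3.mul_isBigO h4
  refine (h1.add h2).congr_left fun y => ?_
  rw [hg0, real_inner_smul_left]
  ring

theorem isMoorePenrose_diagonal {n : Type*} [Fintype n] [DecidableEq n] (d : n → ℝ) :
    IsMoorePenrose (Matrix.diagonal d) (Matrix.diagonal fun i => (d i)⁻¹) := by
  refine ⟨?_, ?_, ?_, ?_⟩ <;> simp only [Matrix.diagonal_mul_diagonal, Matrix.diagonal_transpose]
  · congr 1; funext i
    by_cases h : d i = 0 <;> simp [h]
  · congr 1; funext i
    by_cases h : d i = 0 <;> simp [h]

theorem moorePenroseInv_diagonal {n : Type*} [Fintype n] [DecidableEq n] (d : n → ℝ) :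
    moorePenroseInv (Matrix.diagonal d) = Matrix.diagonal fun i => (d i)⁻¹ :=
  (exists_isMoorePenrose (Matrix.diagonal d)).choose_spec.unique (isMoorePenrose_diagonal d)

namespace StreamingModel

variable {N L M : ℕ} (m : StreamingModel N L M)

/-- With action probabilities `p₁`, `p₂`, the diagonal entry at `s` is the visitation times `∑ p_a
(p₁ p₂ / p_a)² = p₁ p₂ (p₁ + p₂) = p₁ p₂`. -/
theorem fisher_eq (γ : ℝ) (n : Fin N) (θ : EuclideanSpace ℝ (ClientState L M)) :
    m.fisher γ n θ = Matrix.diagonal fun s =>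
      visitation γ (m.trans n) (softPolicy θ) (m.ρ n) s *
        (softProb (θ s) ServiceClass.a₁ * softProb (θ s) ServiceClass.a₂) := by
  have hterm : ∀ s, ∑ a, (visitation γ (m.trans n) (softPolicy θ) (m.ρ n) s * softPolicy θ s a) •
      Matrix.vecMulVec (score θ s a).ofLp (score θ s a).ofLp
      = Matrix.diagonal (Pi.single s (visitation γ (m.trans n) (softPolicy θ) (m.ρ n) s *
        (softProb (θ s) ServiceClass.a₁ * softProb (θ s) ServiceClass.a₂))) := by
    intro s
    have h1 := softProb_pos (θ s) ServiceClass.a₁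
    have h2 := softProb_pos (θ s) ServiceClass.a₂
    have h3 := sum_softProb (θ s)
    rw [sum_serviceClass] at h3 ⊢
    have hd : ∀ x : ℝ, Matrix.vecMulVec (EuclideanSpace.single s x).ofLp
        (EuclideanSpace.single s x).ofLp = Matrix.diagonal (Pi.single s (x * x)) := by
      intro x
      ext i j
      by_cases hi : i = s <;> by_cases hj : j = s <;> by_cases hij : i = j <;>
        simp_all [Matrix.vecMulVec_apply]
    simp_rw [score_eq, hd, softPolicy_eq, ← Matrix.diagonal_smul, Matrix.diagonal_add]
    congr 1
    funext i
    by_cases hi : i = s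
    · subst hi
      simp only [Pi.smul_apply, Pi.single_eq_same, smul_eq_mul, actionSign]
      field_simp
      linear_combination (visitation γ (m.trans n) (softPolicy θ) (m.ρ n) i) * h3
    · simp [hi]
  simp_rw [fisher, hterm]
  ext i j
  rw [Matrix.sum_apply]
  by_cases hij : i = j
  · subst hij
    simp [Matrix.diagonal_apply_eq, Finset.sum_pi_single]
  · simp [Matrix.diagonal_apply_ne _ hij]

/-- The expected stage cost of the Lagrangian, up to an additive constant. -/
noncomputable def lagrangeCost (n : Fin N) (lam : ℝ) (s : ClientState L M) (a : ServiceClass) :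
    ℝ :=
  meanCost (m.trans n) (fun s _ s' => m.c s s') s a + lam * serviceCost a

theorem lagrangian_eq {γ : ℝ} (hγ0 : 0 ≤ γ) (hγ1 : γ < 1) (Kbar : ℝ) (n : Fin N) (lam : ℝ)
    {π : ClientState L M → ServiceClass → ℝ} (hπ : IsPolicy π) :
    m.lagrangian γ Kbar n π lam = ∑ s, ∑ a,
      occupancy γ (m.trans n) π (m.ρ n) s a * m.lagrangeCost n lam s a - lam * (Kbar / N) := by
  simp_rw [lagrangian, Jc, Jg, discountedCost_eq_sum_occupancy hγ0 hγ1 (m.trans_mem n) hπ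
    (m.ρ_mem n), lagrangeCost, meanCost_of_forall_eq (m.trans_mem n) fun _ a => serviceCost a,
    mul_add, Finset.sum_add_distrib, mul_sub, Finset.mul_sum]
  rw [add_sub_assoc]
  congr 2
  exact Finset.sum_congr rfl fun s _ => Finset.sum_congr rfl fun a _ => by ring

/-- The policy gradient theorem for the soft-threshold policy. -/
theorem gradient_lagrangian {γ : ℝ} (hγ0 : 0 ≤ γ) (hγ1 : γ < 1) (Kbar : ℝ) (n : Fin N)
    (θ : EuclideanSpace ℝ (ClientState L M)) (lam : ℝ) {V : ClientState L M → ℝ}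
    (hV : IsValue γ (m.trans n) (softPolicy θ) (m.lagrangeCost n lam) V) :
    gradient (fun θ' => m.lagrangian γ Kbar n (softPolicy θ') lam) θ
      = WithLp.toLp 2 fun s => visitCount γ (m.trans n) (softPolicy θ) (m.ρ n) s *
        ((softProb (θ s) ServiceClass.a₁ * softProb (θ s) ServiceClass.a₂) *
          (qValue γ (m.trans n) (m.lagrangeCost n lam) V s ServiceClass.a₁
            - qValue γ (m.trans n) (m.lagrangeCost n lam) V s ServiceClass.a₂)) := by
  set q := qValue γ (m.trans n) (m.lagrangeCost n lam) V with hq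
  have hcoord : ∀ s, Continuous fun θ' : EuclideanSpace ℝ (ClientState L M) => θ' s := fun s =>
    (EuclideanSpace.proj s : EuclideanSpace ℝ (ClientState L M) →L[ℝ] ℝ).continuous
  have hcont : ∀ s, Continuous fun θ' => visitCount γ (m.trans n) (softPolicy θ') (m.ρ n) s := by
    refine continuous_visitCount hγ0 hγ1 (m.trans_mem n) (m.ρ_mem n) isPolicy_softPolicy ?_
    intro s a
    simp_rw [softPolicy_eq]
    exact (continuous_iff_continuousAt.2 fun x => (hasDerivAt_softProb x a).continuousAt).comp
      (hcoord s)
  -- Performance difference with `V` frozen at `θ`. The advantage averages vanish at `θ' = θ`, so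
  -- the visit counts need only be continuous in the parameter.
  have heq : ∀ θ', m.lagrangian γ Kbar n (softPolicy θ') lam
      = ∑ s, visitCount γ (m.trans n) (softPolicy θ') (m.ρ n) s *
          (∑ a, softProb (θ' s) a * (q s a - V s))
        + (∑ s, m.ρ n s * V s - lam * (Kbar / N)) := by
    intro θ'
    have h := (isOccupancy_occupancy hγ0 hγ1 (m.trans_mem n) (isPolicy_softPolicy θ')
      (m.ρ_mem n)).sum_advantage (m.lagrangeCost n lam) V
    rw [m.lagrangian_eq hγ0 hγ1 Kbar n lam (isPolicy_softPolicy θ')]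
    simp_rw [Finset.mul_sum, ← softPolicy_eq, ← mul_assoc]
    simp only [occupancy] at h ⊢
    rw [h]
    ring
  simp_rw [heq]
  refine HasGradientAt.gradient ?_
  have hs : ∀ s, HasGradientAt (fun θ' : EuclideanSpace ℝ (ClientState L M) =>
      visitCount γ (m.trans n) (softPolicy θ') (m.ρ n) s *
        (∑ a, softProb (θ' s) a * (q s a - V s)))
      (visitCount γ (m.trans n) (softPolicy θ) (m.ρ n) s • EuclideanSpace.single s
        ((softProb (θ s) ServiceClass.a₁ * softProb (θ s) ServiceClass.a₂) *
          (q s ServiceClass.a₁ - q s ServiceClass.a₂))) θ := by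
    intro s
    refine HasGradientAt.mul_of_eq_zero (g := fun θ' : EuclideanSpace ℝ (ClientState L M) =>
      ∑ a, softProb (θ' s) a * (q s a - V s)) ?_ ?_ (hcont s).continuousAt
    · refine hasGradientAt_comp_apply (f := fun x => ∑ a, softProb x a * (q s a - V s)) θ s ?_
      simp_rw [sum_serviceClass]
      have := ((hasDerivAt_softProb (θ s) ServiceClass.a₁).mul_const (q s ServiceClass.a₁ - V s)).add
        ((hasDerivAt_softProb (θ s) ServiceClass.a₂).mul_const (q s ServiceClass.a₂ - V s))
      refine this.congr_deriv ?_
      simp only [actionSign]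
      ring
    · have h1 := hV s
      simp_rw [softPolicy_eq] at h1
      simp_rw [mul_sub, Finset.sum_sub_distrib, ← Finset.sum_mul, sum_softProb]
      rw [hq, ← h1]
      ring
  rw [hasGradientAt_iff_hasFDerivAt]
  have hsum := (HasFDerivAt.fun_sum (u := Finset.univ) fun s _ =>
    hasGradientAt_iff_hasFDerivAt.1 (hs s)).add_const
      (∑ s, m.ρ n s * V s - lam * (Kbar / N))
  rw [← map_sum] at hsum
  refine hsum.congr_fderiv ?_
  congr 1
  ext i
  simp [Pi.single_apply]

/-- The factor `1 / (1 - γ)` remains because the Fisher matrix uses the normalized visitation and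
the gradient the unnormalized visit count. -/
theorem naturalGradient_apply {γ : ℝ} (hγ0 : 0 ≤ γ) (hγ1 : γ < 1) (Kbar : ℝ) (n : Fin N)
    (θ : EuclideanSpace ℝ (ClientState L M)) (lam : ℝ) {V : ClientState L M → ℝ}
    (hV : IsValue γ (m.trans n) (softPolicy θ) (m.lagrangeCost n lam) V) {s : ClientState L M}
    (hs : visitCount γ (m.trans n) (softPolicy θ) (m.ρ n) s ≠ 0) :
    m.naturalGradient γ Kbar n θ lam s
      = (1 / (1 - γ)) * (qValue γ (m.trans n) (m.lagrangeCost n lam) V s ServiceClass.a₁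
            - qValue γ (m.trans n) (m.lagrangeCost n lam) V s ServiceClass.a₂) := by
  have h1 := (softProb_pos (θ s) ServiceClass.a₁).ne'
  have h2 := (softProb_pos (θ s) ServiceClass.a₂).ne'
  have h3 : 1 - γ ≠ 0 := by linarith
  rw [naturalGradient, fisher_eq, moorePenroseInv_diagonal,
    m.gradient_lagrangian hγ0 hγ1 Kbar n θ lam hV]
  simp only [Matrix.mulVec_diagonal, visitation_eq]
  field_simp

end StreamingModel

/-! ### Regret of natural policy gradient against an arbitrary occupancy measure -/

theorem isPolicy_softProb {S : Type*} (θ : S → ℝ) : IsPolicy fun s => softProb (θ s) :=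
  fun _ => ⟨fun _ => (softProb_pos _ _).le, sum_softProb _⟩

section Regret

variable {S : Type*} [Fintype S] {γ : ℝ} {p : S → ServiceClass → S → ℝ} {ρ : S → ℝ}

theorem IsValue.add_mul {A : Type*} [Fintype A] {p : S → A → S → ℝ} {π r r' : S → A → ℝ}
    {V V' : S → ℝ} (hV : IsValue γ p π r V) (hV' : IsValue γ p π r' V') (x : ℝ) :
    IsValue γ p π (fun s a => r s a + x * r' s a) fun s => V s + x * V' s := by
  intro s
  simp only
  rw [hV s, hV' s, Finset.mul_sum, ← Finset.sum_add_distrib]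
  refine Finset.sum_congr rfl fun a _ => ?_
  simp only [qValue, mul_add, Finset.sum_add_distrib, ← mul_assoc]
  have : ∑ s', p s a s' * x * V' s' = x * ∑ s', p s a s' * V' s' := by
    rw [Finset.mul_sum]
    exact Finset.sum_congr rfl fun _ _ => by ring
  rw [this]
  ring

/-- Policy improvement of one exponential weights step. -/
theorem log_partition_le_improvement (hγ0 : 0 ≤ γ) (hγ1 : γ < 1)
    (hp : ∀ s a, p s a ∈ stdSimplex ℝ S) {R : Set S}
    (hR : ∀ s ∈ R, ∀ a, ∀ s' ∉ R, γ * p s a s' = 0) {π' r : S → ServiceClass → ℝ}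
    (hπ' : IsPolicy π') {V V' l : S → ℝ} {κ : ℝ} (hκ : 0 < κ) (hl : ∀ s, 0 ≤ l s)
    (hV' : IsValue γ p π' r V')
    (h : ∀ s ∈ R, ∑ a, π' s a * (κ * (qValue γ p r V s a - V s)) ≤ -l s) :
    ∀ s ∈ R, l s ≤ κ * (V s - V' s) := by
  set f : S → ℝ := fun s => V' s - V s with hf
  -- Bellman equation for `V'` minus `V`: first the one-step advantage, at most `-l` on `R`, then
  -- the discounted future of `f`, nonpositive once `f ≤ 0` on `R`.
  have hrec : ∀ s, κ * f s = ∑ a, π' s a * (κ * (qValue γ p r V s a - V s))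
      + κ * ∑ a, π' s a * (γ * ∑ s', p s a s' * f s') := by
    intro s
    have h1 : V s = ∑ a, π' s a * V s := by rw [← Finset.sum_mul, (hπ' s).2, one_mul]
    have h2 : f s = ∑ a, (π' s a * qValue γ p r V' s a - π' s a * V s) := by
      rw [Finset.sum_sub_distrib, ← hV' s, ← h1]
    rw [h2, Finset.mul_sum, Finset.mul_sum, ← Finset.sum_add_distrib]
    refine Finset.sum_congr rfl fun a _ => ?_
    simp only [qValue, hf, mul_sub, Finset.sum_sub_distrib]
    ring
  have hle : ∀ s ∈ R, f s ≤ ∑ a, π' s a * (γ * ∑ s', p s a s' * f s') := by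
    intro s hs
    have h1 := hrec s
    have h2 := h s hs
    have h3 := hl s
    exact le_of_mul_le_mul_left (by linarith) hκ
  have hneg := nonpos_of_le_discounted hγ0 hγ1 hp hπ' R hR f hle
  intro s hs
  have h1 : ∑ a, π' s a * (γ * ∑ s', p s a s' * f s') ≤ 0 := by
    refine Finset.sum_nonpos fun a _ => mul_nonpos_of_nonneg_of_nonpos ((hπ' s).1 a) ?_
    rw [Finset.mul_sum]
    refine Finset.sum_nonpos fun s' _ => ?_
    by_cases hs' : s' ∈ R
    · rw [← mul_assoc]
      exact mul_nonpos_of_nonneg_of_nonpos (mul_nonneg hγ0 ((hp s a).1 s')) (hneg s' hs')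
    · rw [← mul_assoc, hR s hs a s' hs', zero_mul]
  have h2 := h s hs
  have h3 := hrec s
  have h4 := mul_nonpos_of_nonneg_of_nonpos hκ.le h1
  have h5 : κ * f s = -(κ * (V s - V' s)) := by simp only [hf]; ring
  linarith

/-- The potential is the cross entropy `Φ` of the comparator relative to the current policy. The
log-partition terms are paid for by policy improvement, so the bound telescopes up to changes of
`lam`; keeping `Vc` and `Vg` apart lets the telescoping survive them. -/
theorem naturalGradient_regret (hγ0 : 0 ≤ γ) (hγ1 : γ < 1)
    (hp : ∀ s a, p s a ∈ stdSimplex ℝ S) (hρ : ρ ∈ stdSimplex ℝ S)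
    {rc rg : S → ServiceClass → ℝ} (hrc : ∀ s a, rc s a ∈ Set.Icc (0 : ℝ) 1)
    (hrg : ∀ s a, rg s a ∈ Set.Icc (0 : ℝ) 1) {θ Vc Vg : ℕ → S → ℝ} {lam : ℕ → ℝ} {δ : ℝ}
    (hθ0 : ∀ s, θ 0 s = 0) (hlam0 : lam 0 = 0) (hlam : ∀ t, 0 ≤ lam t)
    (hδ : ∀ t, |lam (t + 1) - lam t| ≤ δ)
    (hVc : ∀ t, IsValue γ p (fun s => softProb (θ t s)) rc (Vc t))
    (hVg : ∀ t, IsValue γ p (fun s => softProb (θ t s)) rg (Vg t))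
    {R : Set S} (hR : ∀ s ∈ R, ∀ a, ∀ s' ∉ R, γ * p s a s' = 0)
    (hstep : ∀ t, ∀ s ∈ R, θ (t + 1) s = θ t s - Real.log 2 / (1 - γ) *
      (qValue γ p (fun s a => rc s a + lam t * rg s a) (fun s => Vc t s + lam t * Vg t s) s
          ServiceClass.a₁
        - qValue γ p (fun s a => rc s a + lam t * rg s a) (fun s => Vc t s + lam t * Vg t s) s
          ServiceClass.a₂))
    {ν : S → ServiceClass → ℝ} (hν : IsOccupancy γ p ρ ν) (hνR : ∀ s ∉ R, ∀ a, ν s a = 0)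
    (T : ℕ) :
    ∑ t ∈ Finset.range T, ((∑ s, ρ s * Vc t s - ∑ s, ∑ a, ν s a * rc s a)
      + lam t * (∑ s, ρ s * Vg t s - ∑ s, ∑ a, ν s a * rg s a))
      ≤ 1 + 1 / (1 - γ) ^ 2 + T * (δ / (1 - γ) ^ 2) := by
  set κ : ℝ := Real.log 2 / (1 - γ) with hκdef
  have hg : 0 < 1 - γ := by linarith
  have hκ : 0 < κ := div_pos (Real.log_pos (by norm_num)) hg
  set r : ℕ → S → ServiceClass → ℝ := fun t s a => rc s a + lam t * rg s a with hr
  set V : ℕ → S → ℝ := fun t s => Vc t s + lam t * Vg t s with hV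
  have hVval : ∀ t, IsValue γ p (fun s => softProb (θ t s)) (r t) (V t) := fun t =>
    (hVc t).add_mul (hVg t) (lam t)
  choose l hl0 hl1 hl2 using fun t s => exists_log_partition (θ t s) κ (qValue γ p (r t) (V t) s)
  simp_rw [← hVval _ _] at hl1 hl2
  have hl1' : ∀ t, ∀ s ∈ R, ∀ a, κ * (qValue γ p (r t) (V t) s a - V t s)
      = Real.log (softProb (θ t s) a) - Real.log (softProb (θ (t + 1) s) a) - l t s := by
    intro t s hs a
    rw [hstep t s hs]
    exact hl1 t s a
  have himp : ∀ t, ∀ s ∈ R, l t s ≤ κ * (V t s - (Vc (t + 1) s + lam t * Vg (t + 1) s)) := by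
    intro t
    refine log_partition_le_improvement hγ0 hγ1 hp hR (isPolicy_softProb (θ (t + 1))) hκ (hl0 t)
      ((hVc (t + 1)).add_mul (hVg (t + 1)) (lam t)) fun s hs => ?_
    rw [hstep t s hs]
    exact hl2 t s
  set n : S → ℝ := fun s => ∑ a, ν s a with hn
  have hn0 : ∀ s, 0 ≤ n s := fun s => Finset.sum_nonneg fun a _ => hν.nonneg s a
  have hnsum : ∑ s, n s = 1 / (1 - γ) := hν.sum_eq hγ1 hp hρ
  set Φ : ℕ → ℝ := fun t => -∑ s, ∑ a, ν s a * Real.log (softProb (θ t s) a) with hΦ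
  set Wc : ℕ → ℝ := fun t => ∑ s, n s * Vc t s with hWc
  set Wg : ℕ → ℝ := fun t => ∑ s, n s * Vg t s with hWg
  have hW : ∀ (U : S → ℝ), (∀ s, U s ∈ Set.Icc (0 : ℝ) (1 / (1 - γ))) →
      0 ≤ ∑ s, n s * U s ∧ ∑ s, n s * U s ≤ 1 / (1 - γ) ^ 2 := by
    intro U hU
    refine ⟨Finset.sum_nonneg fun s _ => mul_nonneg (hn0 s) (hU s).1, ?_⟩
    calc ∑ s, n s * U s ≤ ∑ s, n s * (1 / (1 - γ)) :=
          Finset.sum_le_sum fun s _ => mul_le_mul_of_nonneg_left (hU s).2 (hn0 s)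
      _ = 1 / (1 - γ) ^ 2 := by rw [← Finset.sum_mul, hnsum]; field_simp
  have hWcb := fun t => hW (Vc t) fun s =>
    (hVc t).mem_Icc hγ0 hγ1 hp (isPolicy_softProb _) hrc s
  have hWgb := fun t => hW (Vg t) fun s =>
    (hVg t).mem_Icc hγ0 hγ1 hp (isPolicy_softProb _) hrg s
  set X : ℕ → ℝ := fun t => (∑ s, ρ s * Vc t s - ∑ s, ∑ a, ν s a * rc s a)
      + lam t * (∑ s, ρ s * Vg t s - ∑ s, ∑ a, ν s a * rg s a) with hX
  -- Termwise on `R`: the negative scaled advantage is the increase of the log-probability plus `l`,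
  -- and `himp` bounds `l`. Off `R` the measure `ν` vanishes.
  have hone : ∀ t, κ * X t ≤ Φ t - Φ (t + 1)
      + κ * (Wc t - Wc (t + 1) + lam t * (Wg t - Wg (t + 1))) := by
    intro t
    have e1 : X t = ∑ s, ρ s * V t s - ∑ s, ∑ a, ν s a * r t s a := by
      simp only [hX, hV, hr, mul_add, Finset.sum_add_distrib, mul_sub, Finset.mul_sum]
      have a1 : ∀ s, ρ s * (lam t * Vg t s) = lam t * (ρ s * Vg t s) := fun s => by ring
      have a2 : ∀ s a, ν s a * (lam t * rg s a) = lam t * (ν s a * rg s a) := fun s a => by ring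
      simp_rw [a1, a2]
      ring
    have e2 : κ * X t = ∑ s, ∑ a, -(ν s a * (κ * (qValue γ p (r t) (V t) s a - V t s))) := by
      have h1 := hν.sum_advantage (r t) (V t)
      have h2 : X t = -∑ s, ∑ a, ν s a * (qValue γ p (r t) (V t) s a - V t s) := by linarith
      rw [h2]
      simp_rw [Finset.sum_neg_distrib, mul_neg, Finset.mul_sum]
      congr 1
      exact Finset.sum_congr rfl fun s _ => Finset.sum_congr rfl fun a _ => by ring
    have e3 : Φ t - Φ (t + 1) + κ * (Wc t - Wc (t + 1) + lam t * (Wg t - Wg (t + 1)))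
        = ∑ s, ∑ a, ν s a * (Real.log (softProb (θ (t + 1) s) a)
          - Real.log (softProb (θ t s) a)
          + κ * (V t s - (Vc (t + 1) s + lam t * Vg (t + 1) s))) := by
      have i1 : ∀ s, ∑ a, ν s a * (Real.log (softProb (θ (t + 1) s) a)
          - Real.log (softProb (θ t s) a)
          + κ * (V t s - (Vc (t + 1) s + lam t * Vg (t + 1) s)))
          = ∑ a, ν s a * Real.log (softProb (θ (t + 1) s) a)
            - ∑ a, ν s a * Real.log (softProb (θ t s) a)
            + n s * (κ * (V t s - (Vc (t + 1) s + lam t * Vg (t + 1) s))) := fun s => by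
        simp_rw [mul_add (ν s _), mul_sub (ν s _), Finset.sum_add_distrib,
          Finset.sum_sub_distrib, ← Finset.sum_mul, hn]
      have i2 : κ * (Wc t - Wc (t + 1) + lam t * (Wg t - Wg (t + 1)))
          = ∑ s, n s * (κ * (V t s - (Vc (t + 1) s + lam t * Vg (t + 1) s))) := by
        simp only [hWc, hWg, ← Finset.sum_sub_distrib, Finset.mul_sum, ← Finset.sum_add_distrib]
        refine Finset.sum_congr rfl fun s _ => ?_
        simp only [hV]
        ring
      simp_rw [i1]
      rw [i2, Finset.sum_add_distrib, Finset.sum_sub_distrib]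
      simp only [hΦ]
      ring
    rw [e2, e3]
    refine Finset.sum_le_sum fun s _ => Finset.sum_le_sum fun a _ => ?_
    by_cases hs : s ∈ R
    · rw [hl1' t s hs a, ← mul_neg]
      refine mul_le_mul_of_nonneg_left ?_ (hν.nonneg s a)
      have := himp t s hs
      linarith
    · simp [hνR s hs a]
  -- Summation by parts: the boundary term at `0` drops since `lam 0 = 0`, and each increment of
  -- `lam` costs at most `δ / (1 - γ) ^ 2`.
  have htel : ∀ T : ℕ, κ * ∑ t ∈ Finset.range T, X t ≤ Φ 0 - Φ T
      + κ * (Wc 0 - Wc T - lam T * Wg T + T * (δ / (1 - γ) ^ 2)) := by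
    intro T
    induction T with
    | zero => simp [hlam0]
    | succ T ih =>
      rw [Finset.sum_range_succ, mul_add]
      have h1 := hone T
      have h2 : (lam (T + 1) - lam T) * Wg (T + 1) ≤ δ / (1 - γ) ^ 2 := by
        calc (lam (T + 1) - lam T) * Wg (T + 1) ≤ δ * Wg (T + 1) :=
              mul_le_mul_of_nonneg_right ((le_abs_self _).trans (hδ T)) (hWgb (T + 1)).1
          _ ≤ δ * (1 / (1 - γ) ^ 2) :=
              mul_le_mul_of_nonneg_left (hWgb (T + 1)).2 ((abs_nonneg _).trans (hδ T))
          _ = δ / (1 - γ) ^ 2 := by ring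
      have h3 := mul_le_mul_of_nonneg_left h2 hκ.le
      push_cast
      linarith
  -- The initial policy is uniform and `ν` has mass `1 / (1 - γ)`; with step size `log 2` the
  -- initial potential is exactly `κ`, the source of the `1` in the bound.
  have hΦ0 : Φ 0 = κ := by
    simp only [hΦ, hθ0, log_softProb_zero, ← Finset.sum_mul]
    have : ∑ s, ∑ a, ν s a = 1 / (1 - γ) := hnsum
    rw [this, hκdef]
    ring
  have hΦT : 0 ≤ Φ T := by
    simp only [hΦ, ← Finset.sum_neg_distrib]
    refine Finset.sum_nonneg fun s _ => Finset.sum_nonneg fun a _ => ?_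
    have h1 : softProb (θ T s) a ≤ 1 := by
      rw [← sum_softProb (θ T s)]
      exact Finset.single_le_sum (fun b _ => (softProb_pos _ b).le) (Finset.mem_univ a)
    have h2 := Real.log_nonpos (softProb_pos (θ T s) a).le h1
    nlinarith [hν.nonneg s a, mul_nonneg (hν.nonneg s a) (neg_nonneg.2 h2)]
  refine le_of_mul_le_mul_left ?_ hκ
  have h1 := htel T
  have h2 := mul_nonneg (hlam T) (hWgb T).1
  have h3 : Wc 0 - Wc T - lam T * Wg T + T * (δ / (1 - γ) ^ 2)
      ≤ 1 / (1 - γ) ^ 2 + T * (δ / (1 - γ) ^ 2) := by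
    linarith [(hWcb 0).2, (hWcb T).1]
  have h4 := mul_le_mul_of_nonneg_left h3 hκ.le
  calc κ * ∑ t ∈ Finset.range T, X t ≤ _ := h1
    _ ≤ κ * (1 + 1 / (1 - γ) ^ 2 + T * (δ / (1 - γ) ^ 2)) := by linarith

end Regret

/-! ### Projected dual ascent and constraint violation -/

section Dual

theorem sq_projection_sub_le {b y l : ℝ} (hl : l ∈ Set.Icc 0 b) :
    (max 0 (min b y) - l) ^ 2 ≤ (y - l) ^ 2 := by
  obtain ⟨h0, h1⟩ := hl
  rcases le_total b y with h | h
  · rw [min_eq_left h, max_eq_right (h0.trans h1)]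
    nlinarith
  · rw [min_eq_right h]
    rcases le_total 0 y with h' | h'
    · rw [max_eq_right h']
    · rw [max_eq_left h']
      nlinarith

variable {b η D : ℝ} {lam x : ℕ → ℝ}

theorem projected_mem (hb : 0 ≤ b) (h0 : lam 0 = 0)
    (hstep : ∀ t, lam (t + 1) = max 0 (min b (lam t + η * x t))) (t : ℕ) :
    lam t ∈ Set.Icc 0 b := by
  cases t with
  | zero => rw [h0]; exact ⟨le_rfl, hb⟩
  | succ t => rw [hstep]; exact ⟨le_max_left _ _, max_le hb (min_le_left _ _)⟩

theorem abs_projected_step_le (hb : 0 ≤ b) (hη : 0 ≤ η) (h0 : lam 0 = 0)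
    (hstep : ∀ t, lam (t + 1) = max 0 (min b (lam t + η * x t))) (hx : ∀ t, |x t| ≤ D) (t : ℕ) :
    |lam (t + 1) - lam t| ≤ η * D := by
  have h := sq_projection_sub_le (y := lam t + η * x t) (projected_mem hb h0 hstep t)
  rw [← hstep, add_sub_cancel_left] at h
  refine (sq_le_sq.1 h).trans ?_
  rw [abs_mul, abs_of_nonneg hη]
  exact mul_le_mul_of_nonneg_left (hx t) hη

/-- The regret of projected online gradient ascent. -/
theorem projected_ascent_regret (h0 : lam 0 = 0)
    (hstep : ∀ t, lam (t + 1) = max 0 (min b (lam t + η * x t))) (hx : ∀ t, |x t| ≤ D)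
    {l : ℝ} (hl : l ∈ Set.Icc 0 b) (T : ℕ) :
    2 * η * ∑ t ∈ Finset.range T, (l - lam t) * x t ≤ l ^ 2 + T * (η ^ 2 * D ^ 2) := by
  have h : ∀ T : ℕ, 2 * η * ∑ t ∈ Finset.range T, (l - lam t) * x t
      ≤ l ^ 2 - (lam T - l) ^ 2 + T * (η ^ 2 * D ^ 2) := by
    intro T
    induction T with
    | zero => simp [h0]
    | succ T ih =>
      rw [Finset.sum_range_succ, mul_add]
      have h1 := sq_projection_sub_le (y := lam T + η * x T) hl
      rw [← hstep] at h1
      have h2 : x T ^ 2 ≤ D ^ 2 := sq_le_sq' (abs_le.1 (hx T)).1 (abs_le.1 (hx T)).2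
      have h3 := mul_le_mul_of_nonneg_left h2 (sq_nonneg η)
      push_cast
      nlinarith
  have := h T
  nlinarith [sq_nonneg (lam T - l)]

/-- Primal regret against a Slater point and against the iterates themselves, together with dual
regret, bounds the total constraint violation. -/
theorem violation_mul_le {C G : ℕ → ℝ} {T : ℕ} (hT : 0 < T) {Cs Gs Kbar ξ X Y l : ℝ} (hξ : 0 < ξ)
    (hD : 0 ≤ D) (hGs : ξ ≤ Kbar - Gs) (hCs : Cs ≤ D) (hC : ∀ t, 0 ≤ C t)
    (hself : ∀ u, ∑ t ∈ Finset.range T, (C t - C u + lam t * (G t - G u)) ≤ X)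
    (hslater : ∑ t ∈ Finset.range T, (C t - Cs + lam t * (G t - Gs)) ≤ X)
    (hdual : ∑ t ∈ Finset.range T, (l - lam t) * (G t - Kbar) ≤ Y)
    (hv : 0 < ∑ t ∈ Finset.range T, (G t - Kbar)) :
    (l - D / ξ) * ∑ t ∈ Finset.range T, (G t - Kbar) ≤ X + Y := by
  have hT' : (0 : ℝ) < T := by exact_mod_cast hT
  have hself' := Finset.sum_le_sum fun u (_ : u ∈ Finset.range T) => hself u
  simp only [mul_sub, sub_mul, Finset.sum_add_distrib, Finset.sum_sub_distrib, Finset.sum_const,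
    Finset.card_range, nsmul_eq_mul, ← Finset.sum_mul, ← Finset.mul_sum] at *
  set SC := ∑ t ∈ Finset.range T, C t
  set SG := ∑ t ∈ Finset.range T, G t
  set SL := ∑ t ∈ Finset.range T, lam t
  set SLG := ∑ t ∈ Finset.range T, lam t * G t
  have hSC : 0 ≤ SC := Finset.sum_nonneg fun t _ => hC t
  -- Average of the self-regrets over `u`: the costs cancel, leaving the covariance of multiplier
  -- and constraint value.
  have h1 : SLG - SL * SG / T ≤ X := by
    have : SL * SG / T * T = SL * SG := by field_simp
    refine le_of_mul_le_mul_left (a := (T : ℝ)) ?_ hT'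
    linarith
  set v := SG - T * Kbar with hvdef
  have hw : 0 < v / T := div_pos hv hT'
  have hu : 0 < Kbar - Gs := by linarith
  -- Weights `Kbar - Gs` on the iterates' average and `v / T` on the Slater point make the mixed
  -- constraint value exactly `Kbar`.
  have h2 : (Kbar - Gs + v / T) * (SLG - SL * Kbar) + v / T * (SC - T * Cs)
      ≤ (Kbar - Gs + v / T) * X := by
    have e : (Kbar - Gs + v / T) * (SLG - SL * Kbar) + v / T * (SC - T * Cs)
        = (Kbar - Gs) * (SLG - SL * SG / T)
          + v / T * (SC - T * Cs + (SLG - SL * Gs)) := by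
      rw [hvdef]
      field_simp
      ring
    rw [e, add_mul]
    exact add_le_add (mul_le_mul_of_nonneg_left h1 hu.le) (mul_le_mul_of_nonneg_left hslater hw.le)
  have h3 : -(v * D) ≤ v / T * (SC - T * Cs) := by
    have : v / T * (SC - T * Cs) = v / T * SC - v * Cs := by field_simp
    rw [this]
    have := mul_nonneg hw.le hSC
    have := mul_le_mul_of_nonneg_left hCs hv.le
    linarith
  have h4 : SLG - SL * Kbar - X ≤ v * D / ξ := by
    rw [le_div_iff₀ hξ]
    -- Replacing `Kbar - Gs + v / T` by the smaller `ξ` is legitimate only for a nonnegative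
    -- surplus; otherwise the bound is trivial.
    rcases le_total (SLG - SL * Kbar - X) 0 with h | h
    · exact (mul_nonpos_of_nonpos_of_nonneg h hξ.le).trans (mul_nonneg hv.le hD)
    · have := mul_le_mul_of_nonneg_left (by linarith : ξ ≤ Kbar - Gs + v / T) h
      linarith
  have h5 : D / ξ * v = v * D / ξ := by ring
  rw [← hvdef] at *
  linarith

end Dual

/-! ### Application to the clients -/

namespace StreamingModel

variable {N L M : ℕ} (m : StreamingModel N L M)

theorem card_serviceClass : Fintype.card ServiceClass = 2 := rfl

/-- The expected client cost per stage. -/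
noncomputable def clientCost (n : Fin N) : ClientState L M → ServiceClass → ℝ :=
  meanCost (m.trans n) fun s _ s' => m.c s s'

theorem clientCost_mem_Icc (hc : ∀ s s', m.c s s' ∈ Set.Icc (0 : ℝ) 1) (n : Fin N)
    (s : ClientState L M) (a : ServiceClass) : m.clientCost n s a ∈ Set.Icc (0 : ℝ) 1 :=
  meanCost_mem_Icc (m.trans_mem n) (fun s _ s' => hc s s') s a

theorem serviceCost_mem_Icc (a : ServiceClass) : serviceCost a ∈ Set.Icc (0 : ℝ) 1 := by
  cases a <;> simp [serviceCost]

theorem Jc_eq {γ : ℝ} (hγ0 : 0 ≤ γ) (hγ1 : γ < 1) (n : Fin N)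
    {π : ClientState L M → ServiceClass → ℝ} (hπ : IsPolicy π) :
    m.Jc γ n π = ∑ s, ∑ a, occupancy γ (m.trans n) π (m.ρ n) s a * m.clientCost n s a :=
  discountedCost_eq_sum_occupancy hγ0 hγ1 (m.trans_mem n) hπ (m.ρ_mem n) _

theorem Jg_eq {γ : ℝ} (hγ0 : 0 ≤ γ) (hγ1 : γ < 1) (n : Fin N)
    {π : ClientState L M → ServiceClass → ℝ} (hπ : IsPolicy π) :
    m.Jg γ n π = ∑ s, ∑ a, occupancy γ (m.trans n) π (m.ρ n) s a * serviceCost a := by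
  rw [Jg, discountedCost_eq_sum_occupancy hγ0 hγ1 (m.trans_mem n) hπ (m.ρ_mem n)]
  simp_rw [meanCost_of_forall_eq (m.trans_mem n) fun _ a => serviceCost a]

theorem Jc_mem_Icc {γ : ℝ} (hγ0 : 0 ≤ γ) (hγ1 : γ < 1)
    (hc : ∀ s s', m.c s s' ∈ Set.Icc (0 : ℝ) 1) (n : Fin N)
    {π : ClientState L M → ServiceClass → ℝ} (hπ : IsPolicy π) :
    m.Jc γ n π ∈ Set.Icc (0 : ℝ) (1 / (1 - γ)) := by
  rw [m.Jc_eq hγ0 hγ1 n hπ]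
  exact (isOccupancy_occupancy hγ0 hγ1 (m.trans_mem n) hπ (m.ρ_mem n)).sum_cost_mem_Icc hγ1
    (m.trans_mem n) (m.ρ_mem n) (m.clientCost_mem_Icc hc n)

theorem Jg_mem_Icc {γ : ℝ} (hγ0 : 0 ≤ γ) (hγ1 : γ < 1) (n : Fin N)
    {π : ClientState L M → ServiceClass → ℝ} (hπ : IsPolicy π) :
    m.Jg γ n π ∈ Set.Icc (0 : ℝ) (1 / (1 - γ)) := by
  rw [m.Jg_eq hγ0 hγ1 n hπ]
  exact (isOccupancy_occupancy hγ0 hγ1 (m.trans_mem n) hπ (m.ρ_mem n)).sum_cost_mem_Icc hγ1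
    (m.trans_mem n) (m.ρ_mem n) fun _ => serviceCost_mem_Icc

theorem isOccupancy_softPolicy {γ : ℝ} (hγ0 : 0 ≤ γ) (hγ1 : γ < 1) (n : Fin N)
    (θ : EuclideanSpace ℝ (ClientState L M)) :
    IsOccupancy γ (m.trans n) (m.ρ n) (occupancy γ (m.trans n) (softPolicy θ) (m.ρ n)) :=
  isOccupancy_occupancy hγ0 hγ1 (m.trans_mem n) (isPolicy_softPolicy θ) (m.ρ_mem n)

/-- No occupancy measure charges a state that some soft-threshold policy never visits. -/
theorem occupancy_eq_zero_of_visitCount_softPolicy {γ : ℝ} (hγ0 : 0 ≤ γ) (hγ1 : γ < 1) (n : Fin N)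
    (θ : EuclideanSpace ℝ (ClientState L M)) {ν : ClientState L M → ServiceClass → ℝ}
    (hν : IsOccupancy γ (m.trans n) (m.ρ n) ν) {s : ClientState L M}
    (hs : visitCount γ (m.trans n) (softPolicy θ) (m.ρ n) s = 0) (a : ServiceClass) :
    ν s a = 0 := by
  refine (m.isOccupancy_softPolicy hγ0 hγ1 n θ).eq_zero_of_not_visited hν hγ0 hγ1 (m.trans_mem n)
    (m.ρ_mem n) (fun s hs a => ?_) (by rwa [sum_occupancy (isPolicy_softPolicy θ)]) a
  rw [sum_occupancy (isPolicy_softPolicy θ)] at hs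
  have := visitCount_nonneg hγ0 (m.trans_mem n) (isPolicy_softPolicy θ) (m.ρ_mem n) s
  rw [occupancy, softPolicy_eq]
  exact mul_pos (this.lt_of_ne hs.symm) (softProb_pos _ a)

theorem client_regret {γ : ℝ} (hγ0 : 0 ≤ γ) (hγ1 : γ < 1)
    (hc : ∀ s s', m.c s s' ∈ Set.Icc (0 : ℝ) 1) (Kbar : ℝ) (n : Fin N)
    {θ : ℕ → EuclideanSpace ℝ (ClientState L M)} {lam : ℕ → ℝ} {δ : ℝ}
    (hθ0 : θ 0 = 0) (hlam0 : lam 0 = 0) (hlam : ∀ t, 0 ≤ lam t)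
    (hδ : ∀ t, |lam (t + 1) - lam t| ≤ δ)
    (hstep : ∀ t, θ (t + 1) = θ t - Real.log 2 • m.naturalGradient γ Kbar n (θ t) (lam t))
    {ν : ClientState L M → ServiceClass → ℝ} (hν : IsOccupancy γ (m.trans n) (m.ρ n) ν) (T : ℕ) :
    ∑ t ∈ Finset.range T,
      ((m.Jc γ n (softPolicy (θ t)) - ∑ s, ∑ a, ν s a * m.clientCost n s a)
        + lam t * (m.Jg γ n (softPolicy (θ t)) - ∑ s, ∑ a, ν s a * serviceCost a))
      ≤ 1 + 1 / (1 - γ) ^ 2 + T * (δ / (1 - γ) ^ 2) := by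
  have hsoft : ∀ t, softPolicy (θ t) = fun s => softProb (θ t s) := fun t =>
    funext fun s => funext fun a => softPolicy_eq (θ t) s a
  choose Vc hVc using fun t => exists_isValue hγ0 hγ1 (m.trans_mem n) (isPolicy_softPolicy (θ t))
    (m.clientCost n)
  choose Vg hVg using fun t => exists_isValue hγ0 hγ1 (m.trans_mem n) (isPolicy_softPolicy (θ t))
    (fun _ a => serviceCost a)
  have hJc : ∀ t, m.Jc γ n (softPolicy (θ t)) = ∑ s, m.ρ n s * Vc t s := fun t =>
    discountedCost_eq_sum_value hγ0 hγ1 (m.trans_mem n) (isPolicy_softPolicy _) (m.ρ_mem n) (hVc t)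
  have hJg : ∀ t, m.Jg γ n (softPolicy (θ t)) = ∑ s, m.ρ n s * Vg t s := fun t => by
    refine discountedCost_eq_sum_value hγ0 hγ1 (m.trans_mem n) (isPolicy_softPolicy _)
      (m.ρ_mem n) ?_
    have : meanCost (m.trans n) (fun _ a _ => serviceCost a) = fun _ a => serviceCost a :=
      funext fun s => funext fun a => meanCost_of_forall_eq (m.trans_mem n)
        (fun _ a => serviceCost a) s a
    rw [this]
    exact hVg t
  simp_rw [hJc, hJg]
  -- The states visited under `θ = 0`; they are visited under every other parameter as well, so the
  -- update formula holds on `R` at all times.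
  set R : Set (ClientState L M) :=
    {s | visitCount γ (m.trans n) (softPolicy 0) (m.ρ n) s ≠ 0} with hR
  have hocc := m.isOccupancy_softPolicy hγ0 hγ1 n 0
  have hvis : ∀ t, ∀ s ∈ R, visitCount γ (m.trans n) (softPolicy (θ t)) (m.ρ n) s ≠ 0 := by
    intro t s hs h
    refine hs ?_
    rw [← sum_occupancy (isPolicy_softPolicy 0)]
    exact Finset.sum_eq_zero fun a _ =>
      m.occupancy_eq_zero_of_visitCount_softPolicy hγ0 hγ1 n (θ t) hocc h a
  refine naturalGradient_regret (θ := fun t s => θ t s) (R := R) hγ0 hγ1 (m.trans_mem n)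
    (m.ρ_mem n) (m.clientCost_mem_Icc hc n) (fun _ => serviceCost_mem_Icc) (by simp [hθ0]) hlam0
    hlam hδ (fun t => hsoft t ▸ hVc t) (fun t => hsoft t ▸ hVg t) ?_ ?_ hν ?_ T
  · intro s hs a s' hs'
    refine hocc.closed hγ0 (m.trans_mem n) (m.ρ_mem n) (s := s) (a := a) ?_ ?_
    · have := visitCount_nonneg hγ0 (m.trans_mem n) (isPolicy_softPolicy 0) (m.ρ_mem n) s
      rw [occupancy, softPolicy_eq]
      exact mul_pos (this.lt_of_ne (Ne.symm hs)) (softProb_pos _ a)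
    · rw [sum_occupancy (isPolicy_softPolicy 0)]
      simpa [hR] using hs'
  · intro t s hs
    have hV : IsValue γ (m.trans n) (softPolicy (θ t)) (m.lagrangeCost n (lam t))
        fun s => Vc t s + lam t * Vg t s := (hVc t).add_mul (hVg t) (lam t)
    have h := m.naturalGradient_apply hγ0 hγ1 Kbar n (θ t) (lam t) hV (hvis t s hs)
    rw [hstep t, PiLp.sub_apply, PiLp.smul_apply, h, smul_eq_mul, ← mul_assoc, mul_one_div]
    rfl
  · intro s hs a
    refine m.occupancy_eq_zero_of_visitCount_softPolicy hγ0 hγ1 n 0 hν ?_ a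
    simpa [hR] using hs

theorem deriv_lagrangian (γ Kbar : ℝ) (n : Fin N) (π : ClientState L M → ServiceClass → ℝ)
    (lam : ℝ) : deriv (fun l => m.lagrangian γ Kbar n π l) lam = m.Jg γ n π - Kbar / N := by
  have : HasDerivAt (fun l => m.lagrangian γ Kbar n π l) (m.Jg γ n π - Kbar / N) lam := by
    simpa [lagrangian] using ((hasDerivAt_id lam).mul_const (m.Jg γ n π - Kbar / N)).const_add
      (m.Jc γ n π)
  exact this.deriv

end StreamingModel

/-! ### Rates and the final bounds -/

theorem violation_rate_le {N g ξ h v : ℝ} (hN : 1 ≤ N) (hg : 0 < g) (hg1 : g ≤ 1) (hξ : 0 < ξ)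
    (hh : 1 ≤ h) (hv : N / (g * ξ) * v
      ≤ 3 * N * h / g ^ 2 + (2 * N ^ 3 * h / (g ^ 3 * ξ ^ 2) + N * h / (2 * g))) :
    v ≤ (2 / ξ + 4 * ξ) * N ^ 2 / (g ^ 2 * h) * h ^ 2 := by
  have hN0 : 0 < N := by linarith
  have hh0 : 0 < h := by linarith
  have h1 : (2 / ξ + 4 * ξ) * N ^ 2 / (g ^ 2 * h) * h ^ 2
      = 2 * N ^ 2 * h / (g ^ 2 * ξ) + ξ * h * (4 * (N ^ 2 / g ^ 2)) := by
    field_simp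
  have h2 : v ≤ 2 * N ^ 2 * h / (g ^ 2 * ξ) + ξ * h * (3 * (1 / g) + 1 / 2) := by
    refine le_of_mul_le_mul_left (a := N / (g * ξ)) (hv.trans (le_of_eq ?_)) (by positivity)
    field_simp
    ring
  have e1 : (1 : ℝ) ≤ 1 / g := by rw [le_div_iff₀ hg]; linarith
  have e2 : 1 / g ≤ N ^ 2 / g ^ 2 := by
    rw [div_le_div_iff₀ hg (by positivity)]
    nlinarith [mul_le_mul_of_nonneg_left hg1 hg.le,
      mul_le_mul_of_nonneg_left (one_le_pow₀ hN : (1 : ℝ) ≤ N ^ 2) hg.le]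
  have h3 : ξ * h * (3 * (1 / g) + 1 / 2) ≤ ξ * h * (4 * (N ^ 2 / g ^ 2)) :=
    mul_le_mul_of_nonneg_left (by linarith) (by positivity)
  linarith

theorem theorem2 {N L M : ℕ} (hN : 0 < N) (m : StreamingModel N L M)
    (hc : ∀ s s', m.c s s' ∈ Set.Icc (0 : ℝ) 1)
    (γ : ℝ) (hγ0 : 0 ≤ γ) (hγ1 : γ < 1)
    (K : ℕ) (Kbar : ℝ) (hKbar : Kbar = K / (1 - γ))
    (ξ : ℝ) (hSlater : m.Slater γ Kbar ξ)
    (T : ℕ) (hT : 0 < T) :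
    (∀ πstar : Fin N → ClientState L M → ServiceClass → ℝ,
      (∀ n, IsPolicy (πstar n)) → m.IsOptimal γ Kbar (productPolicy πstar) →
        (1 / (T : ℝ)) * ∑ t ∈ Finset.range T, ∑ n,
            (m.Jc γ n (m.iteratePolicy γ Kbar ξ T t n) - m.Jc γ n (πstar n))
          ≤ 4 * N / ((1 - γ) ^ 2 * √(T : ℝ))) ∧
    max ((1 / (T : ℝ)) * ∑ t ∈ Finset.range T, ∑ n,
            m.Jg γ n (m.iteratePolicy γ Kbar ξ T t n) - Kbar) 0
      ≤ (2 / ξ + 4 * ξ) * (N : ℝ) ^ 2 / ((1 - γ) ^ 2 * √(T : ℝ)) := by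
  obtain ⟨πbar, hπbar, hξ, hslack⟩ := hSlater
  have hN' : (1 : ℝ) ≤ N := by exact_mod_cast hN
  have hT' : (1 : ℝ) ≤ T := by exact_mod_cast hT
  have hg : 0 < 1 - γ := by linarith
  have hg1 : 1 - γ ≤ 1 := by linarith
  set g := 1 - γ with hgdef
  set h := √(T : ℝ) with hh
  have hh1 : 1 ≤ h := Real.one_le_sqrt.2 hT'
  have hhT : h ^ 2 = T := Real.sq_sqrt (by linarith)
  set b : ℝ := 2 * N / (g * ξ) with hb
  have hb0 : 0 ≤ b := by positivity
  set η : ℝ := g / (N * h) with hη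
  have hη0 : 0 < η := by positivity
  set it := m.iterates γ Kbar (Real.log (Fintype.card ServiceClass)) η b with hit
  set θ : Fin N → ℕ → EuclideanSpace ℝ (ClientState L M) := fun n t => (it t).1 n with hθ
  set lam : ℕ → ℝ := fun t => (it t).2 with hlam
  have hpol : ∀ t n, m.iteratePolicy γ Kbar ξ T t n = softPolicy (θ n t) := fun t n => rfl
  simp_rw [hpol]
  set C : ℕ → ℝ := fun t => ∑ n, m.Jc γ n (softPolicy (θ n t)) with hC
  set G : ℕ → ℝ := fun t => ∑ n, m.Jg γ n (softPolicy (θ n t)) with hG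
  have hlam0 : lam 0 = 0 := rfl
  have hlamstep : ∀ t, lam (t + 1) = max 0 (min b (lam t + η * (G t - Kbar))) := by
    intro t
    have : ∑ n, deriv (fun l => m.lagrangian γ Kbar n (softPolicy (θ n t)) l) (lam t)
        = G t - Kbar := by
      simp_rw [StreamingModel.deriv_lagrangian, Finset.sum_sub_distrib]
      simp only [Finset.sum_const, Finset.card_univ, Fintype.card_fin, nsmul_eq_mul, hG]
      field_simp
    rw [← this]
    rfl
  have hθstep : ∀ n t, θ n (t + 1)
      = θ n t - Real.log 2 • m.naturalGradient γ Kbar n (θ n t) (lam t) := by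
    intro n t
    have : Real.log 2 = Real.log (Fintype.card ServiceClass) := by
      rw [StreamingModel.card_serviceClass]; norm_num
    rw [this]
    rfl
  have hlammem := projected_mem hb0 hlam0 hlamstep
  have hCmem : ∀ t, C t ∈ Set.Icc 0 (N / g) := by
    intro t
    have h1 := fun n => m.Jc_mem_Icc hγ0 hγ1 hc n (isPolicy_softPolicy (θ n t))
    refine ⟨Finset.sum_nonneg fun n _ => (h1 n).1, (Finset.sum_le_sum fun n _ => (h1 n).2).trans ?_⟩
    simp [div_eq_mul_inv, hgdef]
  have hGmem : ∀ t, G t ∈ Set.Icc 0 (N / g) := by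
    intro t
    have h1 := fun n => m.Jg_mem_Icc hγ0 hγ1 n (isPolicy_softPolicy (θ n t))
    refine ⟨Finset.sum_nonneg fun n _ => (h1 n).1, (Finset.sum_le_sum fun n _ => (h1 n).2).trans ?_⟩
    simp [div_eq_mul_inv, hgdef]
  have hηD : η * (N / g) = 1 / h := by rw [hη]; field_simp
  -- Either the constraint is void and the multiplier stays at zero, or its violation is bounded.
  have hcases : ((∀ t, G t - Kbar ≤ 0) ∧ ∀ t, lam t = 0) ∨ ∀ t, |G t - Kbar| ≤ N / g := by
    rcases le_or_gt N K with hNK | hNK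
    · left
      have h1 : ∀ t, G t - Kbar ≤ 0 := by
        intro t
        have h2 : (N : ℝ) / g ≤ Kbar := by
          rw [hKbar]
          exact div_le_div_of_nonneg_right (by exact_mod_cast hNK) hg.le
        linarith [(hGmem t).2]
      refine ⟨h1, fun t => ?_⟩
      induction t with
      | zero => rfl
      | succ t ih =>
        rw [hlamstep, ih]
        refine max_eq_left ((min_le_right _ _).trans ?_)
        nlinarith [h1 t]
    · right
      intro t
      have h1 : Kbar ≤ N / g := by
        rw [hKbar]
        exact div_le_div_of_nonneg_right (by exact_mod_cast hNK.le) hg.le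
      have h2 : 0 ≤ Kbar := by rw [hKbar]; positivity
      have h3 := hGmem t
      rw [abs_le]
      constructor <;> linarith [h3.1, h3.2]
  have hδ : ∀ t, |lam (t + 1) - lam t| ≤ 1 / h := by
    rcases hcases with ⟨-, h0⟩ | hx
    · intro t
      rw [h0, h0, sub_zero, abs_zero]
      positivity
    · rw [← hηD]
      exact abs_projected_step_le hb0 hη0.le hlam0 hlamstep hx
  -- Each of the three terms of a client's regret is at most `h / g ^ 2`; for the drift term, `T *
  -- (1 / h) = h`.
  set X : ℝ := 3 * N * h / g ^ 2 with hX
  have hregret : ∀ ν : Fin N → ClientState L M → ServiceClass → ℝ,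
      (∀ n, IsOccupancy γ (m.trans n) (m.ρ n) (ν n)) →
      ∑ t ∈ Finset.range T, (C t - ∑ n, ∑ s, ∑ a, ν n s a * m.clientCost n s a
        + lam t * (G t - ∑ n, ∑ s, ∑ a, ν n s a * serviceCost a)) ≤ X := by
    intro ν hν
    have h1 := Finset.sum_le_sum fun n (_ : n ∈ Finset.univ) =>
      m.client_regret hγ0 hγ1 hc Kbar n (θ := θ n) rfl hlam0 (fun t => (hlammem t).1) hδ
        (hθstep n) (hν n) T
    rw [Finset.sum_comm] at h1
    simp_rw [Finset.sum_add_distrib, ← Finset.mul_sum, Finset.sum_sub_distrib] at h1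
    simp only [Finset.sum_const, Finset.card_univ, Fintype.card_fin, nsmul_eq_mul] at h1
    simp_rw [Finset.sum_add_distrib, Finset.sum_sub_distrib]
    simp only [Finset.sum_const, nsmul_eq_mul] at h1 ⊢
    refine h1.trans ?_
    have h2 : (1 : ℝ) ≤ 1 / g ^ 2 := by
      rw [le_div_iff₀ (by positivity)]
      nlinarith
    have h3 : 1 / g ^ 2 ≤ h / g ^ 2 := by gcongr
    have h4 : (T : ℝ) * (1 / h / g ^ 2) = h / g ^ 2 := by
      rw [← hhT]; field_simp
    rw [← hgdef]
    calc (N : ℝ) * 1 + N * (1 / g ^ 2) + T * (N * (1 / h / g ^ 2))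
        = N * (1 + 1 / g ^ 2 + h / g ^ 2) := by rw [← h4]; ring
      _
        ≤ N * (h / g ^ 2 + h / g ^ 2 + h / g ^ 2) := by
          refine mul_le_mul_of_nonneg_left ?_ (by linarith)
          linarith
      _ = X := by rw [hX]; ring
  have hrhs : 0 ≤ (2 / ξ + 4 * ξ) * (N : ℝ) ^ 2 / (g ^ 2 * h) := by positivity
  constructor
  · intro πstar hπstar hopt
    have hfeas : ∑ n, m.Jg γ n (πstar n) ≤ Kbar := by
      rw [← m.jointJg_productPolicy hγ0 hγ1 hπstar]
      exact hopt.2.1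
    have h1 := hregret _ fun n =>
      isOccupancy_occupancy hγ0 hγ1 (m.trans_mem n) (hπstar n) (m.ρ_mem n)
    simp_rw [← m.Jc_eq hγ0 hγ1 _ (hπstar _), ← m.Jg_eq hγ0 hγ1 _ (hπstar _)] at h1
    -- Dual regret against `l = 0`: since `η * (N / g) = 1 / h`, the squared steps sum to `1`,
    -- leaving `1 / (2 * η)`.
    have hdual : -(∑ t ∈ Finset.range T, lam t * (G t - Kbar)) ≤ N * h / (2 * g) := by
      rcases hcases with ⟨-, h0⟩ | hx
      · simp only [h0, zero_mul, Finset.sum_const_zero, neg_zero]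
        positivity
      · have h2 := projected_ascent_regret hlam0 hlamstep hx (l := 0) ⟨le_rfl, hb0⟩ T
        simp only [zero_sub, neg_mul, Finset.sum_neg_distrib] at h2
        rw [← mul_pow, hηD, ← hhT] at h2
        refine le_of_mul_le_mul_left (a := 2 * η) (h2.trans (le_of_eq ?_)) (by positivity)
        rw [hη]
        field_simp
        ring
    have h2 : ∑ t ∈ Finset.range T, ∑ n,
        (m.Jc γ n (softPolicy (θ n t)) - m.Jc γ n (πstar n)) ≤ X + N * h / (2 * g) := by
      calc _ ≤ ∑ t ∈ Finset.range T, ((C t - ∑ n, m.Jc γ n (πstar n)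
            + lam t * (G t - ∑ n, m.Jg γ n (πstar n))) - lam t * (G t - Kbar)) := by
            refine Finset.sum_le_sum fun t _ => ?_
            rw [Finset.sum_sub_distrib]
            have := mul_le_mul_of_nonneg_left hfeas (hlammem t).1
            simp only [hC]
            linarith
        _ ≤ _ := by
            rw [Finset.sum_sub_distrib]
            linarith
    rw [one_div_mul_eq_div, div_le_iff₀ (by linarith)]
    refine h2.trans ?_
    have h3 : N * h / (2 * g) ≤ N * h / g ^ 2 :=
      div_le_div_of_nonneg_left (by positivity) (by positivity) (by nlinarith)
    have h4 : 4 * N / (g ^ 2 * h) * T = X + N * h / g ^ 2 := by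
      rw [hX, ← hhT]; field_simp; ring
    linarith
  · refine max_le ?_ hrhs
    have havg : 1 / (T : ℝ) * ∑ t ∈ Finset.range T, G t - Kbar
        = (∑ t ∈ Finset.range T, (G t - Kbar)) / T := by
      rw [Finset.sum_sub_distrib]
      simp only [Finset.sum_const, Finset.card_range, nsmul_eq_mul]
      field_simp
    rw [havg]
    rcases le_or_gt (∑ t ∈ Finset.range T, (G t - Kbar)) 0 with hv | hv
    · exact (div_nonpos_of_nonpos_of_nonneg hv (by linarith)).trans hrhs
    have hx : ∀ t, |G t - Kbar| ≤ N / g := by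
      rcases hcases with ⟨h0, -⟩ | hx
      · exact absurd (Finset.sum_nonpos fun t _ => h0 t) (not_le.2 hv)
      · exact hx
    have hocc := fun n => m.isOccupancy_marginal
      (isOccupancy_occupancy hγ0 hγ1 m.jointTrans_mem hπbar m.jointInit_mem) n
    have hself : ∀ u, ∑ t ∈ Finset.range T, (C t - C u + lam t * (G t - G u)) ≤ X := by
      intro u
      have h1 := hregret _ fun n => m.isOccupancy_softPolicy hγ0 hγ1 n (θ n u)
      simp_rw [← m.Jc_eq hγ0 hγ1 _ (isPolicy_softPolicy _),
        ← m.Jg_eq hγ0 hγ1 _ (isPolicy_softPolicy _)] at h1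
      exact h1
    have hslater := hregret _ hocc
    rw [← m.jointJg_eq hγ0 hγ1 hπbar] at hslater
    have hCs : ∑ n, ∑ s, ∑ a, marginal (occupancy γ m.jointTrans πbar m.jointInit) n s a
        * m.clientCost n s a ≤ N / g := by
      refine (Finset.sum_le_sum fun n _ => ((hocc n).sum_cost_mem_Icc hγ1 (m.trans_mem n)
        (m.ρ_mem n) (m.clientCost_mem_Icc hc n)).2).trans ?_
      simp [div_eq_mul_inv, hgdef]
    -- Dual regret against `l = b`: the first summand is `b ^ 2 / (2 * η)`, the second `1 / (2 *
    -- η)`.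
    have hdual : ∑ t ∈ Finset.range T, (b - lam t) * (G t - Kbar)
        ≤ 2 * N ^ 3 * h / (g ^ 3 * ξ ^ 2) + N * h / (2 * g) := by
      have h2 := projected_ascent_regret hlam0 hlamstep hx (l := b) ⟨hb0, le_rfl⟩ T
      rw [← mul_pow, hηD, ← hhT] at h2
      refine le_of_mul_le_mul_left (a := 2 * η) (h2.trans (le_of_eq ?_)) (by positivity)
      rw [hη, hb]
      field_simp
    have hmain := violation_mul_le hT hξ (by positivity) hslack hCs (fun t => (hCmem t).1) hself
      hslater hdual hv
    set v := ∑ t ∈ Finset.range T, (G t - Kbar) with hvdef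
    -- `b` is twice `N / (g * ξ)`, so half of it survives as the coefficient of the violation.
    have hcoef : b - N / g / ξ = N / (g * ξ) := by
      rw [hb]; field_simp; ring
    rw [hcoef] at hmain
    rw [div_le_iff₀ (by linarith)]
    rw [← hhT]
    exact violation_rate_le hN' hg hg1 hξ hh1 hmain
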